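/- Let $\gamma>0$ and let $U\in C^2(\mathbb R)$ be non-constant and $2\pi$-periodic; put $M=\max U'$, $-m=\min U'$ (so $m,M>0$) and $\tilde U(x)=U(-x)$. **Cycles.** For $E>M$ (respectively $E<-m$) the equation $$\frac{dv}{dx}=-\gamma+\frac{E-U'(x)}{v}$$ has exactly one nowhere vanishing $2\pi$-periodic solution $v_E$, and $v_E>0$ (respectively $v_E<0$); it is the cycle of $\ddot x+\gamma\dot x+U'(x)=E$ that encircles the cylinder. Let $\mathcal V_E=2\pi\big[\int_0^{2\pi}dx/v_E(x)\big]^{-1}$ be its mean velocity. For $E>m$ the function $\tilde v_E(x)=-v_{-E}(-x)$ is such a cycle for the potential $\tilde U$ and the field $E$; let $\tilde{\mathcal V}_E$ be its mean velocity. **Expansion of the cycles.** There are $2\pi$-periodic functions $v_1,v_2,\dots$ with zero average such that $$v_1'=-\gamma U',\qquad v_{k+1}'=-\gamma^2v_k-\gamma\sum_{\ell=1}^{k-1}v_\ell'\,v_{k-\ell}\quad(k\ge 1),$$ and for every $N\ge1$ and $E$ large enough $$v_E(x)=\frac E\gamma+\sum_{k=1}^N\frac{v_k(x)}{E^k}+\frac{R_{N,E}(x)}{E^{N+1}},$$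 where $R_{N,E}$ is continuous, $2\pi$-periodic, of zero average, and bounded uniformly in $x$ and in $E$ large. The functions $\tilde v_k(x)=(-1)^{k+1}v_k(-x)$ solve the same system with $\tilde U$ in place of $U$, and $\tilde v_E$ has the corresponding expansion with coefficients $\tilde v_k$. **Adiabatic current.** For $E_1>M$, $E_2>m$ and $T>0$ let $\phi$ be a smooth decreasing function with $\phi(s)=1$ for $s\le0$ and $\phi(s)=-1$ for $s\ge1$. For small $\delta>0$ let $E_\delta$ be the $T$-periodic function equal to $\frac12(E_1-E_2)+\frac12(E_1+E_2)\phi((\tau-T_\delta)/\delta)$ on $[0,T_\delta+\delta]$ and to $\frac12(E_1-E_2)-\frac12(E_1+E_2)\phi((\tau-T+\delta)/\delta)$ on $(T_\delta+\delta,T]$, where $T_\delta>0$, $2\delta<T-T_\delta$, and $T_\delta$ is such that $E_\delta$ has zero average. Let $\mu$ be a probability measure on $S^1\times\mathbb R$ with $\int(1+|v_0|)\log(e+|v_0|)\,d\mu<\infty$. For $\lambda>0$ the equation $\ddot x+\gamma\dot x+U'(x)=E_\delta(\lambda t)$ has for all initial data $(x_0,v_0)$ a unique solution $X_{\lambda,\delta}(t;x_0,v_0)$;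 the current $J_{\lambda,\delta}(t)=\int\mu(dx_0\,dv_0)\,X_{\lambda,\delta}(t;x_0,v_0)/t$ (with $x_0\in[0,2\pi)$) is an absolutely convergent integral for all $t>0$; and the adiabatic current $$J=\lim_{\delta\to0}\liminf_{\lambda\to0}\liminf_{t\to\infty}J_{\lambda,\delta}(t)=\lim_{\delta\to0}\limsup_{\lambda\to0}\limsup_{t\to\infty}J_{\lambda,\delta}(t)$$ exists, equals $\dfrac{E_2\mathcal V_{E_1}+E_1\mathcal V_{-E_2}}{E_1+E_2}$, and so does not depend on $T,\phi,\mu$. **Large fields.** Let $\Delta\neq0$ be fixed, $E_1=E+\Delta$, $E_2=E$. If $U$ has zero average, then as $E\to+\infty$ $$J=\frac{\mathcal V_{E+\Delta}\,\tilde{\mathcal V}_E\,\gamma^5}{2\pi(2E+\Delta)}\left[\left(\frac1{E^4}-\frac1{(E+\Delta)^4}\right)\int_0^{2\pi}U(x)^2\,dx+O\!\left(\frac1{E^{7}}\right)\right],$$ where the constant in $O(\cdot)$ depends only on $\gamma$, $U$ and $\Delta$. Moreover, whether or not $U$ has zero average, there is $E_0$ such that for all $E\ge E_0$ the adiabatic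 current $J$ is nonzero and has the sign of $\Delta$. -/

import Mathlib

open Real Filter Topology MeasureTheory
open scoped ContDiff

/-- `M = max_{[0, 2π]} U'`. -/
noncomputable def slopeMax (U : ℝ → ℝ) : ℝ :=
  sSup (deriv U '' Set.Icc 0 (2 * π))

/-- `m = - min_{[0, 2π]} U'`. -/
noncomputable def slopeNegMin (U : ℝ → ℝ) : ℝ :=
  -sInf (deriv U '' Set.Icc 0 (2 * π))

/-- `v` is the velocity profile of a cycle of `x'' + γ x' + U'(x) = E` encircling the cylinder:
a nowhere vanishing `2π`-periodic solution of `dv/dx = -γ + (E - U'(x)) / v`. -/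
structure IsCycle (γ : ℝ) (U : ℝ → ℝ) (E : ℝ) (v : ℝ → ℝ) : Prop where
  ne_zero : ∀ x, v x ≠ 0
  periodic : Function.Periodic v (2 * π)
  ode : ∀ x, HasDerivAt v (-γ + (E - deriv U x) / v x) x

/-- The cycle `v_E` (meaningful when there is exactly one cycle, which is part of the theorem). -/
noncomputable def cycle (γ : ℝ) (U : ℝ → ℝ) (E : ℝ) : ℝ → ℝ :=
  Classical.epsilon (IsCycle γ U E)

/-- The reflected potential `x ↦ U (-x)`. -/
def reflPot (U : ℝ → ℝ) : ℝ → ℝ := fun x => U (-x)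

/-- The reflected cycle `x ↦ - v_{-E}(-x)`. -/
noncomputable def reflCycle (γ : ℝ) (U : ℝ → ℝ) (E : ℝ) : ℝ → ℝ :=
  fun x => -cycle γ U (-E) (-x)

/-- The mean velocity `2π (∫₀^{2π} dx / v(x))⁻¹` on a cycle `v`. -/
noncomputable def meanVelocity (v : ℝ → ℝ) : ℝ :=
  2 * π * (∫ x in (0 : ℝ)..(2 * π), 1 / v x)⁻¹

/-- `c 1, c 2, …` are the `2π`-periodic zero-average solutions of the triangular system
`c₁' = -γ U'`, `c_{k+1}' = -γ² c_k - γ ∑_{l=1}^{k-1} c_l' c_{k-l}`; the value `c 0` is irrelevant. -/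
structure IsCoeffSequence (γ : ℝ) (U : ℝ → ℝ) (c : ℕ → ℝ → ℝ) : Prop where
  periodic : ∀ k, 1 ≤ k → Function.Periodic (c k) (2 * π)
  average : ∀ k, 1 ≤ k → ∫ x in (0 : ℝ)..(2 * π), c k x = 0
  first : ∀ x, HasDerivAt (c 1) (-γ * deriv U x) x
  step : ∀ k, 1 ≤ k → ∀ x, HasDerivAt (c (k + 1))
    (-γ ^ 2 * c k x - γ * ∑ l ∈ Finset.Icc 1 (k - 1), deriv (c l) x * c (k - l) x) x

/-- `w E = E/γ + ∑_{k=1}^N c_k / E^k + R_{N,E} / E^{N+1}` for every `N ≥ 1` and `E` large, with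
`R_{N,E}` periodic, of zero average, and bounded uniformly in `x` and `E`. -/
def HasLargeFieldExpansion (γ : ℝ) (c : ℕ → ℝ → ℝ) (w : ℝ → ℝ → ℝ) : Prop :=
  ∀ N : ℕ, 1 ≤ N → ∃ C E₀ : ℝ, 0 < E₀ ∧ ∀ E, E₀ ≤ E → ∃ R : ℝ → ℝ,
    Continuous R ∧ Function.Periodic R (2 * π) ∧ (∫ x in (0 : ℝ)..(2 * π), R x = 0) ∧
    (∀ x, |R x| ≤ C) ∧
    ∀ x, w E x = E / γ + ∑ k ∈ Finset.Icc 1 N, c k x / E ^ k + R x / E ^ (N + 1)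

/-- Switching profiles: smooth, decreasing, equal to `1` on `s ≤ 0` and to `-1` on `s ≥ 1`. -/
structure IsSwitch (φ : ℝ → ℝ) : Prop where
  smooth : ContDiff ℝ ∞ φ
  anti : Antitone φ
  left : ∀ s, s ≤ 0 → φ s = 1
  right : ∀ s, 1 ≤ s → φ s = -1

/-- The mollified piecewise constant force on one period; `S` is the switching time `T_δ`. -/
noncomputable def driveOnPeriod (E₁ E₂ T : ℝ) (φ : ℝ → ℝ) (S δ τ : ℝ) : ℝ :=
  if τ ≤ S + δ then (E₁ - E₂) / 2 + (E₁ + E₂) / 2 * φ ((τ - S) / δ)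
  else (E₁ - E₂) / 2 - (E₁ + E₂) / 2 * φ ((τ - T + δ) / δ)

/-- The driving force `E_δ`: the `T`-periodic extension of `driveOnPeriod`. -/
noncomputable def drive (E₁ E₂ T : ℝ) (φ : ℝ → ℝ) (S δ τ : ℝ) : ℝ :=
  driveOnPeriod E₁ E₂ T φ S δ (T * Int.fract (τ / T))

/-- The switching time `S = T_δ` is admissible: it fits into the period and makes the force average
to zero. -/
def IsSwitchTime (E₁ E₂ T : ℝ) (φ : ℝ → ℝ) (δ S : ℝ) : Prop :=
  0 < S ∧ 2 * δ < T - S ∧ ∫ τ in (0 : ℝ)..T, drive E₁ E₂ T φ S δ τ = 0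

/-- `X` solves `X'' + γ X' + U'(X) = F(t)` with `X(0) = x₀`, `X'(0) = v₀`. -/
structure IsTrajectory (γ : ℝ) (U F : ℝ → ℝ) (x₀ v₀ : ℝ) (X : ℝ → ℝ) : Prop where
  position : X 0 = x₀
  velocity : deriv X 0 = v₀
  differentiable : Differentiable ℝ X
  ode : ∀ t, HasDerivAt (deriv X) (F t - γ * deriv X t - deriv U (X t)) t

/-- The solution with given initial data (existence and uniqueness are part of the theorem). -/
noncomputable def trajectory (γ : ℝ) (U F : ℝ → ℝ) (x₀ v₀ : ℝ) : ℝ → ℝ :=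
  Classical.epsilon (IsTrajectory γ U F x₀ v₀)

/-- The drift `X(t; x₀, v₀) / t` as a function of the initial point of the cylinder; the initial
position is represented in `[0, 2π)`. -/
noncomputable def drift (γ : ℝ) (U F : ℝ → ℝ) (t : ℝ) (p : AddCircle (2 * π) × ℝ) : ℝ :=
  haveI : Fact (0 < 2 * π) := ⟨Real.two_pi_pos⟩
  trajectory γ U F (AddCircle.equivIco (2 * π) 0 p.1 : ℝ) p.2 t / t

/-- The current at time `t` for the initial law `μ`. -/
noncomputable def current (γ : ℝ) (U F : ℝ → ℝ) (μ : Measure (AddCircle (2 * π) × ℝ)) (t : ℝ) : ℝ :=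
  ∫ p, drift γ U F t p ∂μ

/-- `J = lim_{δ→0} liminf_{ε→0} liminf_{t→∞} j δ ε t = lim_{δ→0} limsup_{ε→0} limsup_{t→∞} j δ ε t`,
where `δ, ε > 0`; upper and lower limits are taken in the extended reals. -/
def IsAdiabaticLimit (j : ℝ → ℝ → ℝ → ℝ) (J : ℝ) : Prop :=
  Tendsto (fun δ => liminf (fun ε => liminf (fun t => ((j δ ε t : ℝ) : EReal)) atTop) (𝓝[>] 0))
    (𝓝[>] 0) (𝓝 (J : EReal)) ∧
  Tendsto (fun δ => limsup (fun ε => limsup (fun t => ((j δ ε t : ℝ) : EReal)) atTop) (𝓝[>] 0))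
    (𝓝[>] 0) (𝓝 (J : EReal))

/-- `J` is the adiabatic current for the force with amplitudes `E₁, E₂`: whatever the period `T`, the
switching profile `φ`, the admissible switching times `S δ = T_δ` and the initial law `μ` with
`∫ (1 + |v₀|) log (e + |v₀|) dμ < ∞`, the equation of motion is well posed, the current is
a convergent integral, and its adiabatic limit is `J`. -/
def IsAdiabaticCurrent (γ : ℝ) (U : ℝ → ℝ) (E₁ E₂ J : ℝ) : Prop :=
  ∀ (T : ℝ) (φ S : ℝ → ℝ) (μ : Measure (AddCircle (2 * π) × ℝ)),
    0 < T → IsSwitch φ → (∀ᶠ δ in 𝓝[>] (0 : ℝ), IsSwitchTime E₁ E₂ T φ δ (S δ)) →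
    IsProbabilityMeasure μ →
    Integrable (fun p : AddCircle (2 * π) × ℝ => (1 + |p.2|) * Real.log (Real.exp 1 + |p.2|)) μ →
    (∀ δ, 0 < δ → IsSwitchTime E₁ E₂ T φ δ (S δ) → ∀ ε, 0 < ε →
      (∀ x₀ v₀ : ℝ, ∃! X : ℝ → ℝ,
        IsTrajectory γ U (fun t => drive E₁ E₂ T φ (S δ) δ (ε * t)) x₀ v₀ X) ∧
      ∀ t, 0 < t → Integrable (drift γ U (fun s => drive E₁ E₂ T φ (S δ) δ (ε * s)) t) μ) ∧
    IsAdiabaticLimit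
      (fun δ ε t => current γ U (fun s => drive E₁ E₂ T φ (S δ) δ (ε * s)) μ t) J

/-!
Cycles, their large-field expansion and the adiabatic current of a damped particle in a periodic
potential.

*Cycles.* For `E > max U'` the equation for `v` is solved by a fixed point of the Poincaré map of an
invariant strip (`exists_isCycle`). Everything about cycles is read off from extrema of periodic
functions: at an extremum of `v` one has `γ v = E - U'`, which bounds `v` and fixes its sign; at an
extremum of `v² - w²`, whose derivative is `-2γ (v - w)`, two cycles agree, which is uniqueness. The
case `E < min U'` follows by reflection.

*Expansion.* The triangular system is solvable in periodic functions since the sum on its right side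
is a total derivative (`cycleCoeff_spec`). The truncated series solves the cycle equation up to
`O(E⁻ᴺ)` (`truncatedCycle_residual`), and the extremum argument for `v² - p²` turns this residual
into a bound for the distance to the cycle (`IsCycle.abs_sub_le`).

*Adiabatic current.* Under a constant force the deviation `u = x' - v(x)` from the cycle satisfies
`u' = -((E - U'(x)) / v(x)) u` along every trajectory, so it decays exponentially and the trajectory
moves with the mean velocity of the cycle up to a bounded error
(`IsCycle.exists_displacement_bound`). Per period of the force, of duration `T / ε`, the bounded
errors and the switches, of duration `δ / ε`, contribute `O(1 + δ / ε)`
(`exists_period_displacement_bound`). The current at time `t` is therefore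
`J + O(ε + δ) + O_ε(1 / t)`, which gives the iterated limits.

*Large fields.* The sign of `J` is that of the difference of the rescaled periods
`E ∫ dx / ṽ_E - (E + Δ) ∫ dx / v_{E + Δ}`. In the expansion of `E ∫ dx / v_E` in powers of `1 / E`
(`exists_abs_mul_integral_inv_sub_le`) the coefficients up to order six are invariant under
reflection of the potential, so the difference is governed by the term of order four, a positive
multiple of `∫ c₁²`, where `c₁` is `-γ U` for `U` of zero average (`exists_abs_period_sub_le`).
-/

/-! ### Global solutions of Lipschitz differential equations -/

theorem norm_intervalIntegral_le_cosh {E : Type*} [NormedAddCommGroup E] [NormedSpace ℝ E]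
    {g : ℝ → E} {A l : ℝ} (hl : 0 < l) (hg : ∀ s, ‖g s‖ ≤ A * cosh (l * s)) (t : ℝ) :
    ‖∫ s in (0 : ℝ)..t, g s‖ ≤ A / l * cosh (l * t) := by
  have hA : 0 ≤ A := by simpa using (norm_nonneg _).trans (hg 0)
  have hint : ∫ s in (0 : ℝ)..t, A * cosh (l * s) = A / l * sinh (l * t) := by
    have hd : ∀ s ∈ Set.uIcc 0 t, HasDerivAt (fun s => A / l * sinh (l * s)) (A * cosh (l * s)) s := by
      intro s _
      refine (((hasDerivAt_id' s).const_mul l).sinh.const_mul (A / l)).congr_deriv ?_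
      field_simp
    rw [intervalIntegral.integral_eq_sub_of_hasDerivAt hd
      (Continuous.intervalIntegrable (by fun_prop) _ _)]
    simp
  have h1 := intervalIntegral.norm_integral_le_abs_of_norm_le (a := 0) (b := t) (μ := volume)
    (f := g) (g := fun s => A * cosh (l * s)) (Eventually.of_forall hg)
    (Continuous.intervalIntegrable (by fun_prop) _ _)
  rw [hint, abs_mul, abs_of_nonneg (by positivity : 0 ≤ A / l)] at h1
  refine h1.trans (mul_le_mul_of_nonneg_left ?_ (by positivity))
  rw [abs_le]
  constructor
  · have := exp_pos (l * t)
    have h2 := exp_pos (-(l * t))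
    rw [sinh_eq, cosh_eq]; linarith
  · exact (sinh_lt_cosh _).le

/-- A field that is globally Lipschitz in the space variable, and bounded in time at the origin,
has global solutions: the Picard operator, conjugated by the weight `cosh (l t)`, is a contraction
of the bounded continuous functions on the whole line. -/
theorem exists_hasDerivAt_of_lipschitzWith {E : Type*} [NormedAddCommGroup E] [NormedSpace ℝ E]
    [CompleteSpace E] {f : ℝ → E → E} {K : NNReal} {C : ℝ}
    (hf : Continuous (Function.uncurry f)) (hK : ∀ t, LipschitzWith K (f t))
    (hC : ∀ t, ‖f t 0‖ ≤ C) (y₀ : E) :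
    ∃ y : ℝ → E, y 0 = y₀ ∧ ∀ t, HasDerivAt y (f t (y t)) t := by
  set l : ℝ := K + 1 with hl
  have hl0 : 0 < l := by positivity
  have hcosh : ∀ s : ℝ, 0 < cosh (l * s) := fun s => cosh_pos _
  -- the integrand `f s (w s)` with `w = cosh (l s) z`
  let F : BoundedContinuousFunction ℝ E → ℝ → E := fun z s => f s (cosh (l * s) • z s)
  have hFc : ∀ z, Continuous (F z) := fun z =>
    hf.comp (continuous_id.prodMk ((by fun_prop : Continuous fun s : ℝ => cosh (l * s)).smul
      z.continuous))
  have hFb : ∀ z s, ‖F z s‖ ≤ (C + K * ‖z‖) * cosh (l * s) := by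
    intro z s
    have h1 := (hK s).dist_le_mul (cosh (l * s) • z s) 0
    rw [dist_eq_norm, dist_eq_norm, sub_zero, norm_smul, Real.norm_of_nonneg (hcosh s).le] at h1
    have h2 : ‖F z s‖ ≤ ‖F z s - f s 0‖ + ‖f s 0‖ := by
      simpa using norm_add_le (F z s - f s 0) (f s 0)
    have h3 := z.norm_coe_le_norm s
    have h4 : C ≤ C * cosh (l * s) :=
      le_mul_of_one_le_right ((norm_nonneg _).trans (hC 0)) (one_le_cosh _)
    have h5 : (K : ℝ) * (cosh (l * s) * ‖z s‖) ≤ K * (cosh (l * s) * ‖z‖) := by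
      gcongr
    have h6 := hC s
    simp only [F] at h2 ⊢
    linarith
  have hFd : ∀ z z' s, ‖F z s - F z' s‖ ≤ (K * dist z z') * cosh (l * s) := by
    intro z z' s
    have h1 := (hK s).dist_le_mul (cosh (l * s) • z s) (cosh (l * s) • z' s)
    rw [dist_eq_norm, dist_eq_norm, ← smul_sub, norm_smul, Real.norm_of_nonneg (hcosh s).le,
      ← dist_eq_norm (z s)] at h1
    refine h1.trans ?_
    have := BoundedContinuousFunction.dist_coe_le_dist (f := z) (g := z') s
    calc (K : ℝ) * (cosh (l * s) * dist (z s) (z' s)) ≤ K * (cosh (l * s) * dist z z') := by gcongr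
      _ = _ := by ring
  let P : BoundedContinuousFunction ℝ E → ℝ → E := fun z t =>
    (cosh (l * t))⁻¹ • (y₀ + ∫ s in (0 : ℝ)..t, F z s)
  have hPc : ∀ z, Continuous (P z) := by
    intro z
    refine Continuous.smul ?_ (continuous_const.add ?_)
    · exact (by fun_prop : Continuous fun s : ℝ => cosh (l * s)).inv₀ fun s => (hcosh s).ne'
    · exact intervalIntegral.continuous_primitive (fun a b => (hFc z).intervalIntegrable a b) 0
  have hPb : ∀ z t, ‖P z t‖ ≤ ‖y₀‖ + (C + K * ‖z‖) / l := by
    intro z t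
    have h1 := norm_intervalIntegral_le_cosh hl0 (hFb z) t
    rw [norm_smul, norm_inv, Real.norm_of_nonneg (hcosh t).le, inv_mul_le_iff₀ (hcosh t)]
    refine (norm_add_le _ _).trans ?_
    have h2 : ‖y₀‖ ≤ ‖y₀‖ * cosh (l * t) :=
      le_mul_of_one_le_right (norm_nonneg _) (one_le_cosh _)
    linarith
  let T : BoundedContinuousFunction ℝ E → BoundedContinuousFunction ℝ E := fun z =>
    BoundedContinuousFunction.ofNormedAddCommGroup (P z) (hPc z) _ (hPb z)
  have hT : ContractingWith (K / (K + 1)) T := by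
    constructor
    · exact (div_lt_one (by positivity)).2 (lt_add_one K)
    · refine LipschitzWith.of_dist_le_mul fun z z' => ?_
      rw [BoundedContinuousFunction.dist_le (by positivity)]
      intro t
      change dist (P z t) (P z' t) ≤ _
      have h1 := norm_intervalIntegral_le_cosh hl0 (hFd z z') t
      rw [dist_eq_norm, ← smul_sub, norm_smul, norm_inv, Real.norm_of_nonneg (hcosh t).le,
        inv_mul_le_iff₀ (hcosh t), add_sub_add_left_eq_sub,
        ← intervalIntegral.integral_sub ((hFc z).intervalIntegrable _ _)
          ((hFc z').intervalIntegrable _ _)]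
      refine h1.trans (le_of_eq ?_)
      push_cast
      ring
  obtain ⟨z, hz⟩ : ∃ z, T z = z := ⟨_, hT.fixedPoint_isFixedPt⟩
  have hzt : ∀ t, cosh (l * t) • z t = y₀ + ∫ s in (0 : ℝ)..t, F z s := by
    intro t
    have h1 : P z t = z t := congrArg (fun w : BoundedContinuousFunction ℝ E => w t) hz
    rw [← h1]
    simp only [P]
    rw [smul_smul, mul_inv_cancel₀ (hcosh t).ne', one_smul]
  refine ⟨fun t => cosh (l * t) • z t, by simpa using hzt 0, fun t => ?_⟩
  have h1 := ((hFc z).integral_hasStrictDerivAt 0 t).hasDerivAt.const_add y₀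
  exact h1.congr_of_eventuallyEq (Eventually.of_forall hzt)

/-! ### Periodic functions -/

namespace Function.Periodic

variable {f f' : ℝ → ℝ} {c : ℝ}

theorem exists_forall_le (hf : Function.Periodic f c) (hc : c ≠ 0) (hcont : Continuous f) :
    ∃ x₀, ∀ x, f x ≤ f x₀ := by
  obtain ⟨_, ⟨x₀, rfl⟩, h⟩ := (hf.compact_of_continuous hc hcont).exists_isGreatest
    (Set.range_nonempty f)
  exact ⟨x₀, fun x => h ⟨x, rfl⟩⟩

theorem exists_forall_ge (hf : Function.Periodic f c) (hc : c ≠ 0) (hcont : Continuous f) :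
    ∃ x₀, ∀ x, f x₀ ≤ f x := by
  obtain ⟨_, ⟨x₀, rfl⟩, h⟩ := (hf.compact_of_continuous hc hcont).exists_isLeast
    (Set.range_nonempty f)
  exact ⟨x₀, fun x => h ⟨x, rfl⟩⟩

theorem exists_forall_abs_le (hf : Function.Periodic f c) (hc : c ≠ 0) (hcont : Continuous f) :
    ∃ C, 0 < C ∧ ∀ x, |f x| ≤ C := by
  obtain ⟨x₀, h⟩ := Function.Periodic.exists_forall_le (f := fun x => |f x|)
    (fun x => by simp only [hf x]) hc hcont.abs
  exact ⟨|f x₀| + 1, by positivity, fun x => (h x).trans (by linarith)⟩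

theorem deriv_periodic (hf : Function.Periodic f c) : Function.Periodic (deriv f) c := fun x => by
  rw [← deriv_comp_add_const, funext hf]

theorem exists_max_hasDerivAt (hf : Function.Periodic f c) (hc : c ≠ 0)
    (hd : ∀ x, HasDerivAt f (f' x) x) : ∃ x₀, (∀ x, f x ≤ f x₀) ∧ f' x₀ = 0 := by
  obtain ⟨x₀, h⟩ := hf.exists_forall_le hc
    (continuous_iff_continuousAt.2 fun x => (hd x).continuousAt)
  exact ⟨x₀, h, IsLocalMax.hasDerivAt_eq_zero (Eventually.of_forall h) (hd x₀)⟩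

theorem exists_min_hasDerivAt (hf : Function.Periodic f c) (hc : c ≠ 0)
    (hd : ∀ x, HasDerivAt f (f' x) x) : ∃ x₀, (∀ x, f x₀ ≤ f x) ∧ f' x₀ = 0 := by
  obtain ⟨x₀, h⟩ := hf.exists_forall_ge hc
    (continuous_iff_continuousAt.2 fun x => (hd x).continuousAt)
  exact ⟨x₀, h, IsLocalMin.hasDerivAt_eq_zero (Eventually.of_forall h) (hd x₀)⟩

theorem integral_deriv_eq_zero (hf : Function.Periodic f c) (hd : ∀ x, HasDerivAt f (f' x) x)
    (hc : Continuous f') : ∫ x in (0 : ℝ)..c, f' x = 0 := by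
  rw [intervalIntegral.integral_eq_sub_of_hasDerivAt (fun x _ => hd x) (hc.intervalIntegrable _ _)]
  simpa using sub_eq_zero.2 (hf 0)

end Function.Periodic

theorem continuous_of_forall_hasDerivAt {f f' : ℝ → ℝ} (hd : ∀ x, HasDerivAt f (f' x) x) :
    Continuous f :=
  continuous_iff_continuousAt.2 fun x => (hd x).continuousAt

theorem two_pi_ne_zero : (2 * π : ℝ) ≠ 0 := two_pi_pos.ne'

/-- Reflecting a periodic function does not change its integral over a period. -/
theorem Function.Periodic.integral_comp_neg {f : ℝ → ℝ} {c : ℝ} (hf : Function.Periodic f c) :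
    ∫ x in (0 : ℝ)..c, f (-x) = ∫ x in (0 : ℝ)..c, f x := by
  rw [intervalIntegral.integral_comp_neg]
  have := hf.intervalIntegral_add_eq (-c) 0
  simpa using this

/-! ### Cycles -/

section Slope

variable {U : ℝ → ℝ}

theorem deriv_le_slopeMax (hc : Continuous (deriv U)) (hp : Function.Periodic (deriv U) (2 * π))
    (x : ℝ) : deriv U x ≤ slopeMax U := by
  obtain ⟨y, hy, hxy⟩ := hp.exists_mem_Ico₀ two_pi_pos x
  rw [hxy]
  exact le_csSup (isCompact_Icc.image hc).bddAbove ⟨y, Set.Ico_subset_Icc_self hy, rfl⟩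

theorem neg_slopeNegMin_le_deriv (hc : Continuous (deriv U))
    (hp : Function.Periodic (deriv U) (2 * π)) (x : ℝ) : -slopeNegMin U ≤ deriv U x := by
  obtain ⟨y, hy, hxy⟩ := hp.exists_mem_Ico₀ two_pi_pos x
  rw [hxy, slopeNegMin, neg_neg]
  exact csInf_le (isCompact_Icc.image hc).bddBelow ⟨y, Set.Ico_subset_Icc_self hy, rfl⟩

theorem slopeMax_le {B : ℝ} (hB : ∀ x, |deriv U x| ≤ B) : slopeMax U ≤ B := by
  refine csSup_le ((Set.nonempty_Icc.2 two_pi_pos.le).image _) ?_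
  rintro _ ⟨x, -, rfl⟩
  exact (le_abs_self _).trans (hB x)

theorem slopeNegMin_le {B : ℝ} (hB : ∀ x, |deriv U x| ≤ B) : slopeNegMin U ≤ B := by
  rw [slopeNegMin, neg_le]
  refine le_csInf ((Set.nonempty_Icc.2 two_pi_pos.le).image _) ?_
  rintro _ ⟨x, -, rfl⟩
  exact neg_le_of_abs_le (hB x)

end Slope

theorem reflPot_reflPot (U : ℝ → ℝ) : reflPot (reflPot U) = U := by
  funext x; simp [reflPot]

theorem deriv_reflPot (U : ℝ → ℝ) (x : ℝ) : deriv (reflPot U) x = -deriv U (-x) :=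
  deriv_comp_neg U x

namespace IsCycle

variable {γ E : ℝ} {U v w : ℝ → ℝ}

theorem continuous (h : IsCycle γ U E v) : Continuous v := continuous_of_forall_hasDerivAt h.ode

/-- The velocity is minimal where `v' = 0`, that is, where `γ v = E - U'`. -/
theorem le_of_forall_le (h : IsCycle γ U E v) (hγ : 0 < γ) {a : ℝ} (ha : ∀ x, a ≤ E - deriv U x)
    (x : ℝ) : a / γ ≤ v x := by
  obtain ⟨x₀, hx₀, h0⟩ := h.periodic.exists_min_hasDerivAt two_pi_ne_zero h.ode
  have h1 : E - deriv U x₀ = γ * v x₀ := by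
    have := h.ne_zero x₀
    field_simp at h0
    linarith
  refine le_trans ?_ (hx₀ x)
  rw [div_le_iff₀ hγ, mul_comm, ← h1]
  exact ha x₀

theorem ge_of_forall_ge (h : IsCycle γ U E v) (hγ : 0 < γ) {b : ℝ} (hb : ∀ x, E - deriv U x ≤ b)
    (x : ℝ) : v x ≤ b / γ := by
  obtain ⟨x₀, hx₀, h0⟩ := h.periodic.exists_max_hasDerivAt two_pi_ne_zero h.ode
  have h1 : E - deriv U x₀ = γ * v x₀ := by
    have := h.ne_zero x₀
    field_simp at h0
    linarith
  refine le_trans (hx₀ x) ?_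
  rw [le_div_iff₀ hγ, mul_comm, ← h1]
  exact hb x₀

theorem pos (h : IsCycle γ U E v) (hγ : 0 < γ) (hE : ∀ x, deriv U x < E) (x : ℝ) : 0 < v x :=
  lt_of_le_of_ne (by simpa using h.le_of_forall_le hγ (a := 0) (fun y => (sub_pos.2 (hE y)).le) x)
    (h.ne_zero x).symm

theorem neg (h : IsCycle γ U E v) (hγ : 0 < γ) (hE : ∀ x, E < deriv U x) (x : ℝ) : v x < 0 :=
  lt_of_le_of_ne (by simpa using h.ge_of_forall_ge hγ (b := 0) (fun y => (sub_neg.2 (hE y)).le) x)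
    (h.ne_zero x)

/-- Two cycles have the same kinetic energy: `(v² - w²)' = -2 γ (v - w)` vanishes at the maximum
of the periodic function `v² - w²`. -/
theorem sq_le_sq (h : IsCycle γ U E v) (h' : IsCycle γ U E w) (hγ : 0 < γ) (x : ℝ) :
    v x ^ 2 ≤ w x ^ 2 := by
  obtain ⟨x₀, hx₀, h0⟩ := Function.Periodic.exists_max_hasDerivAt
    (f := fun x => v x ^ 2 - w x ^ 2) (f' := fun x => -(2 * γ) * (v x - w x))
    (fun x => by simp only [h.periodic x, h'.periodic x]) two_pi_ne_zero (fun x => by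
      have h2 := h.ne_zero x
      have h3 := h'.ne_zero x
      refine (((h.ode x).pow 2).sub ((h'.ode x).pow 2)).congr_deriv ?_
      field_simp
      ring)
  have h1 : v x₀ = w x₀ := by
    rcases mul_eq_zero.1 h0 with h1 | h1
    · linarith
    · linarith
  have := hx₀ x
  simp only [h1] at this
  linarith

theorem unique_of_lt (h : IsCycle γ U E v) (h' : IsCycle γ U E w) (hγ : 0 < γ)
    (hE : ∀ x, deriv U x < E) : v = w := funext fun x =>
  (pow_left_inj₀ (h.pos hγ hE x).le (h'.pos hγ hE x).le two_ne_zero).1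
    (le_antisymm (h.sq_le_sq h' hγ x) (h'.sq_le_sq h hγ x))

theorem reflect (h : IsCycle γ U E v) : IsCycle γ (reflPot U) (-E) (fun x => -v (-x)) where
  ne_zero x := neg_ne_zero.2 (h.ne_zero _)
  periodic x := by
    have := h.periodic (-x - 2 * π)
    simp only [sub_add_cancel] at this
    simp only [neg_add', ← this]
  ode x := by
    have := h.ne_zero (-x)
    refine (((h.ode (-x)).comp x (hasDerivAt_neg x)).neg).congr_deriv ?_
    rw [deriv_reflPot]
    field_simp
    ring

end IsCycle

/-- A cycle exists for fields above the maximal slope. With `1/v` cut off at small `v` the equation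
is globally solvable, its solutions do not leave a suitable strip `lo ≤ v ≤ hi`, and the Poincaré
map of the strip has a fixed point by the intermediate value theorem. -/
theorem exists_isCycle {γ E : ℝ} {U : ℝ → ℝ} (hγ : 0 < γ) (hc : Continuous (deriv U))
    (hp : Function.Periodic (deriv U) (2 * π)) (hE : ∀ x, deriv U x < E) :
    ∃ v, IsCycle γ U E v := by
  obtain ⟨xm, hxm⟩ := hp.exists_forall_le two_pi_ne_zero hc
  obtain ⟨xn, hxn⟩ := hp.exists_forall_ge two_pi_ne_zero hc
  set a := E - deriv U xm with ha
  set b := E - deriv U xn with hb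
  have ha0 : 0 < a := sub_pos.2 (hE _)
  have hal : ∀ x, a ≤ E - deriv U x := fun x => by linarith [hxm x]
  have hbu : ∀ x, E - deriv U x ≤ b := fun x => by linarith [hxn x]
  have hb0 : 0 < b := ha0.trans_le ((hal xm).trans (hbu xm))
  have hab : a ≤ b := (hal xm).trans (hbu xm)
  set lo := a / (2 * γ) with hlo
  set hi := 2 * b / γ with hhi
  have hlo0 : 0 < lo := by positivity
  have hlohi : lo ≤ hi := by
    rw [hlo, hhi, div_le_div_iff₀ (by positivity) hγ]
    nlinarith
  let f : ℝ → ℝ → ℝ := fun x y => -γ + (E - deriv U x) * (max lo y)⁻¹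
  have hmax : ∀ y, 0 < max lo y := fun y => hlo0.trans_le (le_max_left _ _)
  have hfc : Continuous (Function.uncurry f) := by
    refine continuous_const.add ((continuous_const.sub (hc.comp continuous_fst)).mul ?_)
    exact (continuous_const.max continuous_snd).inv₀ fun p => (hmax _).ne'
  have hK : ∀ x, LipschitzWith (b / lo ^ 2).toNNReal (f x) := by
    intro x
    refine LipschitzWith.of_dist_le_mul fun y y' => ?_
    rw [Real.coe_toNNReal _ (by positivity), dist_eq, dist_eq]
    have h1 : f x y - f x y' = (E - deriv U x) * ((max lo y' - max lo y) /
        (max lo y * max lo y')) := by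
      have := (hmax y).ne'
      have := (hmax y').ne'
      simp only [f]
      field_simp
      ring
    have h2 : |max lo y' - max lo y| ≤ |y - y'| := by
      rw [abs_sub_comm y y', max_comm lo, max_comm lo]
      exact abs_max_sub_max_le_abs _ _ _
    have h3 : lo ^ 2 ≤ max lo y * max lo y' := by
      rw [sq]
      exact mul_le_mul (le_max_left _ _) (le_max_left _ _) hlo0.le (hmax _).le
    rw [h1, abs_mul, abs_div, abs_of_pos (mul_pos (hmax y) (hmax y')),
      abs_of_nonneg (ha0.le.trans (hal x))]
    calc (E - deriv U x) * (|max lo y' - max lo y| / (max lo y * max lo y'))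
        ≤ b * (|y - y'| / lo ^ 2) := by
          gcongr
          exact hbu x
      _ = _ := by ring
  have hC : ∀ x, ‖f x 0‖ ≤ γ + b * lo⁻¹ := by
    intro x
    refine (norm_add_le _ _).trans ?_
    rw [norm_neg, Real.norm_of_nonneg hγ.le, max_eq_left hlo0.le, norm_mul,
      Real.norm_of_nonneg (ha0.le.trans (hal x)), Real.norm_of_nonneg (by positivity : 0 ≤ lo⁻¹)]
    gcongr
    exact hbu x
  choose y hy0 hy using fun a => exists_hasDerivAt_of_lipschitzWith hfc hK hC a
  have hyc : ∀ a, Continuous (y a) := fun a => continuous_of_forall_hasDerivAt (hy a)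
  have hlow : ∀ s, lo ≤ s → ∀ x ∈ Set.Icc 0 (2 * π), lo ≤ y s x := by
    intro s hs
    refine image_le_of_deriv_right_lt_deriv_boundary (f := fun _ => lo) (f' := fun _ => 0)
      continuousOn_const (fun x _ => hasDerivWithinAt_const _ _ _) (by rw [hy0]; exact hs)
      (hy s) ?_
    intro x _ hx
    simp only [f, ← hx, max_self]
    have h1 : 2 * γ ≤ (E - deriv U x) * lo⁻¹ := by
      rw [← div_eq_mul_inv, le_div_iff₀ hlo0, hlo]
      have h2 := hal x
      have h3 : 2 * γ * (a / (2 * γ)) = a := by field_simp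
      linarith
    linarith
  have hupp : ∀ s, s ≤ hi → ∀ x ∈ Set.Icc 0 (2 * π), y s x ≤ hi := by
    intro s hs
    refine image_le_of_deriv_right_lt_deriv_boundary (B := fun _ => hi) (B' := fun _ => 0)
      (hyc s).continuousOn (fun x _ => (hy s x).hasDerivWithinAt) (by rw [hy0]; exact hs)
      (fun x => hasDerivAt_const _ _) ?_
    intro x _ hx
    simp only [f, hx, max_eq_right hlohi]
    have h1 : (E - deriv U x) * hi⁻¹ < γ := by
      rw [← div_eq_mul_inv, div_lt_iff₀ (hlo0.trans_le hlohi), hhi]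
      have h2 := hbu x
      have h3 : γ * (2 * b / γ) = 2 * b := by field_simp
      linarith
    linarith
  have hP : Continuous fun s => y s (2 * π) := by
    refine (LipschitzWith.of_dist_le_mul (K := (exp ((b / lo ^ 2).toNNReal * (2 * π))).toNNReal)
      fun s s' => ?_).continuous
    have h1 := dist_le_of_trajectories_ODE (a := 0) (b := 2 * π) (δ := dist s s') hK
      (hyc s).continuousOn (fun x _ => (hy s x).hasDerivWithinAt)
      (hyc s').continuousOn (fun x _ => (hy s' x).hasDerivWithinAt) (by rw [hy0, hy0]) (2 * π)
      ⟨two_pi_pos.le, le_rfl⟩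
    rw [Real.coe_toNNReal _ (exp_pos _).le]
    simpa [mul_comm] using h1
  obtain ⟨s, hs, hfix⟩ := exists_mem_Icc_isFixedPt_of_mapsTo hP.continuousOn hlohi
    (fun s hs => ⟨hlow s hs.1 _ ⟨two_pi_pos.le, le_rfl⟩, hupp s hs.2 _ ⟨two_pi_pos.le, le_rfl⟩⟩)
  -- the shifted solution has the same initial value
  have hper : Function.Periodic (y s) (2 * π) := by
    have h1 : (fun x => y s (x + 2 * π)) = y s := by
      refine ODE_solution_unique_univ (v := f) (s := fun _ => Set.univ) (t₀ := 0)
        (fun x => (hK x).lipschitzOnWith) (fun x => ⟨?_, trivial⟩)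
        (fun x => ⟨hy s x, trivial⟩) ?_
      · have h2 := (hy s (x + 2 * π)).comp_add_const x (2 * π)
        simpa only [f, hp x] using h2
      · simpa [hy0] using hfix.eq
    exact fun x => congrFun h1 x
  have hge : ∀ x, lo ≤ y s x := by
    intro x
    obtain ⟨x', hx', hxx'⟩ := hper.exists_mem_Ico₀ two_pi_pos x
    rw [hxx']
    exact hlow s hs.1 x' (Set.Ico_subset_Icc_self hx')
  refine ⟨y s, fun x => (hlo0.trans_le (hge x)).ne', hper, fun x => ?_⟩
  simpa only [f, max_eq_right (hge x), div_eq_mul_inv] using hy s x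

section Cycle

variable {γ E : ℝ} {U : ℝ → ℝ}

theorem isCycle_cycle_of_exists (h : ∃ v, IsCycle γ U E v) : IsCycle γ U E (cycle γ U E) :=
  Classical.epsilon_spec h

theorem existsUnique_isCycle_of_lt (hγ : 0 < γ) (hc : Continuous (deriv U))
    (hp : Function.Periodic (deriv U) (2 * π)) (hE : ∀ x, deriv U x < E) :
    ∃! v, IsCycle γ U E v := by
  obtain ⟨v, hv⟩ := exists_isCycle hγ hc hp hE
  exact ⟨v, hv, fun w hw => hw.unique_of_lt hv hγ hE⟩

theorem continuous_deriv_reflPot (hc : Continuous (deriv U)) :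
    Continuous (deriv (reflPot U)) := by
  rw [funext (deriv_reflPot U)]
  exact (hc.comp continuous_neg).neg

theorem periodic_reflPot (hp : Function.Periodic U (2 * π)) :
    Function.Periodic (reflPot U) (2 * π) := fun x => by
  simp only [reflPot, neg_add']
  exact hp.sub_eq _

theorem existsUnique_isCycle_of_gt (hγ : 0 < γ) (hc : Continuous (deriv U))
    (hp : Function.Periodic U (2 * π)) (hE : ∀ x, E < deriv U x) :
    ∃! v, IsCycle γ U E v := by
  have hE' : ∀ x, deriv (reflPot U) x < -E := fun x => by
    rw [deriv_reflPot]; exact neg_lt_neg (hE _)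
  obtain ⟨v, hv⟩ := exists_isCycle hγ (continuous_deriv_reflPot hc)
    (periodic_reflPot hp).deriv_periodic hE'
  have hv' := hv.reflect
  rw [neg_neg, reflPot_reflPot] at hv'
  refine ⟨_, hv', fun w hw => funext fun x => ?_⟩
  have := congrFun (hw.reflect.unique_of_lt hv hγ hE') (-x)
  simp only [neg_neg] at this
  simp only [← this, neg_neg]

theorem isCycle_cycle_of_lt (hγ : 0 < γ) (hc : Continuous (deriv U))
    (hp : Function.Periodic U (2 * π)) (hE : ∀ x, deriv U x < E) :
    IsCycle γ U E (cycle γ U E) :=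
  isCycle_cycle_of_exists (existsUnique_isCycle_of_lt hγ hc hp.deriv_periodic hE).exists

theorem isCycle_cycle_of_gt (hγ : 0 < γ) (hc : Continuous (deriv U))
    (hp : Function.Periodic U (2 * π)) (hE : ∀ x, E < deriv U x) :
    IsCycle γ U E (cycle γ U E) :=
  isCycle_cycle_of_exists (existsUnique_isCycle_of_gt hγ hc hp hE).exists

theorem isCycle_reflCycle (hγ : 0 < γ) (hc : Continuous (deriv U))
    (hp : Function.Periodic U (2 * π)) (hE : ∀ x, -E < deriv U x) :
    IsCycle γ (reflPot U) E (reflCycle γ U E) := by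
  have h := (isCycle_cycle_of_gt hγ hc hp hE).reflect
  rwa [neg_neg] at h

end Cycle

/-! ### The coefficients of the expansion -/

/-- The primitive of `h` of zero average over `[0, 2π]`. -/
noncomputable def zeroMeanPrimitive (h : ℝ → ℝ) (x : ℝ) : ℝ :=
  (∫ y in (0 : ℝ)..x, h y) - (∫ z in (0 : ℝ)..(2 * π), ∫ y in (0 : ℝ)..z, h y) / (2 * π)

section ZeroMeanPrimitive

variable {h : ℝ → ℝ}

theorem hasDerivAt_zeroMeanPrimitive (hc : Continuous h) (x : ℝ) :
    HasDerivAt (zeroMeanPrimitive h) (h x) x :=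
  (hc.integral_hasStrictDerivAt 0 x).hasDerivAt.sub_const _

theorem integral_zeroMeanPrimitive (hc : Continuous h) :
    ∫ x in (0 : ℝ)..(2 * π), zeroMeanPrimitive h x = 0 := by
  have h1 : Continuous fun x => ∫ y in (0 : ℝ)..x, h y :=
    intervalIntegral.continuous_primitive (fun a b => hc.intervalIntegrable a b) 0
  simp only [zeroMeanPrimitive]
  rw [intervalIntegral.integral_sub (h1.intervalIntegrable _ _) (by simp),
    intervalIntegral.integral_const]
  have := two_pi_ne_zero
  simp only [sub_zero, smul_eq_mul]
  field_simp
  ring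

theorem periodic_zeroMeanPrimitive (hc : Continuous h) (hp : Function.Periodic h (2 * π))
    (h0 : ∫ x in (0 : ℝ)..(2 * π), h x = 0) :
    Function.Periodic (zeroMeanPrimitive h) (2 * π) := fun x => by
  have h1 := hp.intervalIntegral_add_eq x 0
  rw [zero_add, h0] at h1
  have h2 := intervalIntegral.integral_add_adjacent_intervals
    (hc.intervalIntegrable 0 x) (hc.intervalIntegrable (μ := volume) x (x + 2 * π))
  simp only [zeroMeanPrimitive]
  linarith

end ZeroMeanPrimitive

/-- The recursive solution of the triangular system by zero-average primitives; the sum over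
`i < k` is the sum over `l = i + 1` in the system. -/
noncomputable def cycleCoeff (γ : ℝ) (U : ℝ → ℝ) : ℕ → ℝ → ℝ
  | 0 => 0
  | 1 => zeroMeanPrimitive fun x => -γ * deriv U x
  | k + 2 => zeroMeanPrimitive fun x => -γ ^ 2 * cycleCoeff γ U (k + 1) x -
      γ * ∑ i : Fin k, deriv (cycleCoeff γ U (i + 1)) x * cycleCoeff γ U (k - i) x

/-- The right side of the equation for `c (k + 1)` in the triangular system, with the summation
index shifted by one. -/
noncomputable def coeffRhs (γ : ℝ) (U : ℝ → ℝ) (c : ℕ → ℝ → ℝ) : ℕ → ℝ → ℝ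
  | 0, x => -γ * deriv U x
  | k + 1, x => -γ ^ 2 * c (k + 1) x -
      γ * ∑ i ∈ Finset.range k, deriv (c (i + 1)) x * c (k - i) x

/-- The system is solvable in periodic functions because the sum on its right side is the derivative
of the periodic function `½ ∑ c_l c_{k-l}`. -/
theorem cycleCoeff_spec {γ : ℝ} {U : ℝ → ℝ} (hd : Differentiable ℝ U) (hc : Continuous (deriv U))
    (hp : Function.Periodic U (2 * π)) (k : ℕ) :
    Function.Periodic (cycleCoeff γ U (k + 1)) (2 * π) ∧
    (∫ x in (0 : ℝ)..(2 * π), cycleCoeff γ U (k + 1) x = 0) ∧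
    Differentiable ℝ (cycleCoeff γ U (k + 1)) ∧ Continuous (deriv (cycleCoeff γ U (k + 1))) ∧
    ∀ x, HasDerivAt (cycleCoeff γ U (k + 1)) (coeffRhs γ U (cycleCoeff γ U) k x) x := by
  induction k using Nat.strong_induction_on with
  | _ k ih =>
    suffices H : Continuous (coeffRhs γ U (cycleCoeff γ U) k) ∧
        Function.Periodic (coeffRhs γ U (cycleCoeff γ U) k) (2 * π) ∧
        (∫ x in (0 : ℝ)..(2 * π), coeffRhs γ U (cycleCoeff γ U) k x = 0) ∧
        cycleCoeff γ U (k + 1) = zeroMeanPrimitive (coeffRhs γ U (cycleCoeff γ U) k) by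
      obtain ⟨h1, h2, h3, h4⟩ := H
      have h6 : ∀ x, HasDerivAt (cycleCoeff γ U (k + 1)) (coeffRhs γ U (cycleCoeff γ U) k x) x :=
        fun x => by rw [h4]; exact hasDerivAt_zeroMeanPrimitive h1 x
      refine ⟨?_, ?_, fun x => (h6 x).differentiableAt, ?_, h6⟩
      · rw [h4]; exact periodic_zeroMeanPrimitive h1 h2 h3
      · rw [h4]; exact integral_zeroMeanPrimitive h1
      · rw [funext fun x => (h6 x).deriv]; exact h1
    match k with
    | 0 =>
      refine ⟨continuous_const.mul hc, fun x => ?_, ?_, ?_⟩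
      · simp only [coeffRhs, hp.deriv_periodic x]
      · simp only [coeffRhs]
        rw [intervalIntegral.integral_const_mul,
          hp.integral_deriv_eq_zero (fun x => (hd x).hasDerivAt) hc, mul_zero]
      · rw [cycleCoeff]
        rfl
    | k + 1 =>
      set c := cycleCoeff γ U with hcdef
      obtain ⟨kp, ka, kd, -, -⟩ := ih k (Nat.lt_succ_self k)
      have hpi : ∀ i, 1 ≤ i → i ≤ k → Function.Periodic (c i) (2 * π) := fun i h1 h2 => by
        have := (ih (i - 1) (by omega)).1
        rwa [Nat.sub_add_cancel h1] at this
      have hdi : ∀ i, 1 ≤ i → i ≤ k → Differentiable ℝ (c i) := fun i h1 h2 => by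
        have := (ih (i - 1) (by omega)).2.2.1
        rwa [Nat.sub_add_cancel h1] at this
      have hci : ∀ i, 1 ≤ i → i ≤ k → Continuous (deriv (c i)) := fun i h1 h2 => by
        have := (ih (i - 1) (by omega)).2.2.2.1
        rwa [Nat.sub_add_cancel h1] at this
      have hsumc : Continuous fun x => ∑ i ∈ Finset.range k, deriv (c (i + 1)) x * c (k - i) x := by
        refine continuous_finsetSum _ fun i hi => ?_
        have hi := Finset.mem_range.1 hi
        exact (hci _ (by omega) (by omega)).mul (hdi _ (by omega) (by omega)).continuous
      have hsum0 : ∫ x in (0 : ℝ)..(2 * π),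
          ∑ i ∈ Finset.range k, deriv (c (i + 1)) x * c (k - i) x = 0 := by
        refine Function.Periodic.integral_deriv_eq_zero
          (f := fun x => 1 / 2 * ∑ i ∈ Finset.range k, c (i + 1) x * c (k - i) x)
          (fun x => ?_) (fun x => ?_) hsumc
        · simp only
          congr 1
          refine Finset.sum_congr rfl fun i hi => ?_
          have hi := Finset.mem_range.1 hi
          rw [hpi _ (by omega) (by omega), hpi _ (by omega) (by omega)]
        · have h1 : HasDerivAt (fun x => 1 / 2 * ∑ i ∈ Finset.range k, c (i + 1) x * c (k - i) x)
              (1 / 2 * ∑ i ∈ Finset.range k, (deriv (c (i + 1)) x * c (k - i) x +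
                c (i + 1) x * deriv (c (k - i)) x)) x := by
            refine (HasDerivAt.fun_sum fun i hi => ?_).const_mul _
            have hi := Finset.mem_range.1 hi
            exact (hdi _ (by omega) (by omega) x).hasDerivAt.mul
              (hdi _ (by omega) (by omega) x).hasDerivAt
          refine h1.congr_deriv ?_
          have h2 : ∑ i ∈ Finset.range k, c (i + 1) x * deriv (c (k - i)) x =
              ∑ i ∈ Finset.range k, deriv (c (i + 1)) x * c (k - i) x := by
            rw [← Finset.sum_range_reflect]
            refine Finset.sum_congr rfl fun i hi => ?_
            have hi := Finset.mem_range.1 hi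
            rw [show k - 1 - i + 1 = k - i by omega, show k - (k - 1 - i) = i + 1 by omega,
              mul_comm]
          rw [Finset.sum_add_distrib, h2]
          ring
      refine ⟨?_, fun x => ?_, ?_, ?_⟩
      · exact (continuous_const.mul kd.continuous).sub (continuous_const.mul hsumc)
      · simp only [coeffRhs, kp x]
        congr 2
        refine Finset.sum_congr rfl fun i hi => ?_
        have hi := Finset.mem_range.1 hi
        rw [(hpi (i + 1) (by omega) (by omega)).deriv_periodic, hpi _ (by omega) (by omega)]
      · have i1 : IntervalIntegrable (fun x => -γ ^ 2 * c (k + 1) x) volume 0 (2 * π) :=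
          (continuous_const.mul kd.continuous).intervalIntegrable _ _
        have i2 : IntervalIntegrable (fun x => γ * ∑ i ∈ Finset.range k,
            deriv (c (i + 1)) x * c (k - i) x) volume 0 (2 * π) :=
          (continuous_const.mul hsumc).intervalIntegrable _ _
        simp only [coeffRhs]
        rw [intervalIntegral.integral_sub i1 i2,
          intervalIntegral.integral_const_mul, intervalIntegral.integral_const_mul, ka, hsum0]
        simp
      · rw [hcdef, cycleCoeff]
        congr 1
        funext x
        rw [coeffRhs, Finset.sum_range]

theorem isCoeffSequence_cycleCoeff {γ : ℝ} {U : ℝ → ℝ} (hd : Differentiable ℝ U)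
    (hc : Continuous (deriv U)) (hp : Function.Periodic U (2 * π)) :
    IsCoeffSequence γ U (cycleCoeff γ U) where
  periodic k hk := by
    have := (cycleCoeff_spec (γ := γ) hd hc hp (k - 1)).1
    rwa [Nat.sub_add_cancel hk] at this
  average k hk := by
    have := (cycleCoeff_spec (γ := γ) hd hc hp (k - 1)).2.1
    rwa [Nat.sub_add_cancel hk] at this
  first := (cycleCoeff_spec hd hc hp 0).2.2.2.2
  step k hk x := by
    obtain ⟨k, rfl⟩ : ∃ j, k = j + 1 := ⟨k - 1, by omega⟩
    refine ((cycleCoeff_spec hd hc hp (k + 1)).2.2.2.2 x).congr_deriv ?_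
    rw [coeffRhs]
    congr 2
    refine Eq.trans ?_ (Finset.sum_Ico_add' (fun l => deriv (cycleCoeff γ U l) x *
      cycleCoeff γ U (k + 1 - l) x) 0 k 1)
    rw [Finset.range_eq_Ico]
    exact Finset.sum_congr rfl fun i _ => by rw [Nat.add_sub_add_right]

namespace IsCoeffSequence

variable {γ : ℝ} {U : ℝ → ℝ} {c : ℕ → ℝ → ℝ}

theorem differentiable (h : IsCoeffSequence γ U c) {k : ℕ} (hk : 1 ≤ k) :
    Differentiable ℝ (c k) := by
  obtain rfl | hk := hk.eq_or_lt
  · exact fun x => (h.first x).differentiableAt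
  · obtain ⟨k, rfl⟩ : ∃ j, k = j + 1 := ⟨k - 1, by omega⟩
    exact fun x => (h.step k (by omega) x).differentiableAt

theorem continuous_deriv (h : IsCoeffSequence γ U c) (hc : Continuous (deriv U)) {k : ℕ}
    (hk : 1 ≤ k) : Continuous (deriv (c k)) := by
  induction k using Nat.strong_induction_on with
  | _ k ih =>
    obtain rfl | hk' := hk.eq_or_lt
    · rw [funext fun x => (h.first x).deriv]
      exact continuous_const.mul hc
    · obtain ⟨k, rfl⟩ : ∃ j, k = j + 1 := ⟨k - 1, by omega⟩
      rw [funext fun x => (h.step k (by omega) x).deriv]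
      refine (continuous_const.mul (h.differentiable (by omega)).continuous).sub
        (continuous_const.mul (continuous_finsetSum _ fun i hi => ?_))
      have hi := Finset.mem_Icc.1 hi
      exact (ih i (by omega) hi.1).mul (h.differentiable (by omega)).continuous

/-- A common bound for the first coefficients and their derivatives. -/
theorem exists_bound (h : IsCoeffSequence γ U c) (hc : Continuous (deriv U)) (N : ℕ) :
    ∃ B, 0 < B ∧ ∀ k, 1 ≤ k → k ≤ N → ∀ x, |c k x| ≤ B ∧ |deriv (c k) x| ≤ B := by
  induction N with
  | zero => exact ⟨1, one_pos, fun k h1 h2 => by omega⟩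
  | succ N ih =>
    obtain ⟨B, hB, hN⟩ := ih
    obtain ⟨B1, hB1, h1⟩ := (h.periodic (N + 1) (by omega)).exists_forall_abs_le two_pi_ne_zero
      (h.differentiable (by omega)).continuous
    obtain ⟨B2, hB2, h2⟩ := (h.periodic (N + 1) (by omega)).deriv_periodic.exists_forall_abs_le
      two_pi_ne_zero (h.continuous_deriv hc (by omega))
    refine ⟨B + B1 + B2, by positivity, fun k hk hkN x => ?_⟩
    rcases Nat.lt_or_ge N k with hlt | hle
    · obtain rfl : k = N + 1 := by omega
      constructor
      · linarith [h1 x]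
      · linarith [h2 x]
    · have := hN k hk hle x
      constructor <;> linarith

theorem reflect (h : IsCoeffSequence γ U c) :
    IsCoeffSequence γ (reflPot U) (fun k x => (-1) ^ (k + 1) * c k (-x)) where
  periodic k hk x := by
    simp only [neg_add', (h.periodic k hk).sub_eq]
  average k hk := by
    rw [intervalIntegral.integral_const_mul, (h.periodic k hk).integral_comp_neg, h.average k hk,
      mul_zero]
  first x := by
    refine (((h.first (-x)).comp x (hasDerivAt_neg x)).const_mul _).congr_deriv ?_
    rw [deriv_reflPot]
    ring
  step k hk x := by
    refine (((h.step k hk (-x)).comp x (hasDerivAt_neg x)).const_mul _).congr_deriv ?_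
    have h1 : ∑ l ∈ Finset.Icc 1 (k - 1), deriv (fun x => (-1) ^ (l + 1) * c l (-x)) x *
        ((-1) ^ (k - l + 1) * c (k - l) (-x)) =
        (-1) ^ (k + 1) * ∑ l ∈ Finset.Icc 1 (k - 1), deriv (c l) (-x) * c (k - l) (-x) := by
      rw [Finset.mul_sum]
      refine Finset.sum_congr rfl fun l hl => ?_
      have hl := Finset.mem_Icc.1 hl
      rw [deriv_const_mul_field, deriv_comp_neg]
      have h2 : (-1 : ℝ) ^ (k + 1) = (-1) ^ (l + 1) * (-1) ^ (k - l + 1) * (-1) := by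
        rw [← pow_add, ← pow_succ, show l + 1 + (k - l + 1) + 1 = k + 1 + 2 by omega,
          pow_add _ (k + 1) 2]
        norm_num
      rw [h2]
      ring
    rw [h1]
    ring

end IsCoeffSequence

/-! ### The large-field expansion of the cycles -/

/-- The expansion of the cycle truncated after order `N`. -/
noncomputable def truncatedCycle (γ : ℝ) (c : ℕ → ℝ → ℝ) (N : ℕ) (E x : ℝ) : ℝ :=
  E / γ + ∑ k ∈ Finset.Icc 1 N, c k x / E ^ k

section Expansion

variable {γ : ℝ} {U : ℝ → ℝ} {c : ℕ → ℝ → ℝ}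

theorem periodic_truncatedCycle (h : IsCoeffSequence γ U c) (N : ℕ) (E : ℝ) :
    Function.Periodic (truncatedCycle γ c N E) (2 * π) := fun x => by
  simp only [truncatedCycle]
  congr 1
  refine Finset.sum_congr rfl fun k hk => ?_
  rw [h.periodic k (Finset.mem_Icc.1 hk).1]

theorem hasDerivAt_truncatedCycle (h : IsCoeffSequence γ U c) (N : ℕ) (E x : ℝ) :
    HasDerivAt (truncatedCycle γ c N E) (∑ k ∈ Finset.Icc 1 N, deriv (c k) x / E ^ k) x :=
  (HasDerivAt.fun_sum fun k hk => ((h.differentiable (Finset.mem_Icc.1 hk).1 x).hasDerivAt.div_const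
    (E ^ k))).const_add _

theorem sum_Icc_succ_eq {M : Type*} [AddCommMonoid M] (f : ℕ → M) (n : ℕ) :
    ∑ k ∈ Finset.Icc 1 (n + 1), f k = f 1 + ∑ k ∈ Finset.Icc 1 n, f (k + 1) := by
  induction n with
  | zero => simp
  | succ n ih => rw [Finset.sum_Icc_succ_top (by omega), ih, Finset.sum_Icc_succ_top (by omega),
      add_assoc]

/-- The truncated expansion solves `p p' + γ p - E + U' = 0` up to terms of order `E⁻ᴺ`: by the
triangular system all terms of lower order cancel. -/
theorem truncatedCycle_residual (h : IsCoeffSequence γ U c) (hγ : γ ≠ 0) (n : ℕ) {E : ℝ}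
    (hE : E ≠ 0) (x : ℝ) :
    truncatedCycle γ c (n + 1) E x * (∑ k ∈ Finset.Icc 1 (n + 1), deriv (c k) x / E ^ k) +
      γ * truncatedCycle γ c (n + 1) E x - E + deriv U x =
    γ * c (n + 1) x / E ^ (n + 1) +
      ∑ p ∈ Finset.Icc 1 (n + 1) ×ˢ Finset.Icc 1 (n + 1) with n + 1 ≤ p.1 + p.2,
        deriv (c p.1) x / E ^ p.1 * (c p.2 x / E ^ p.2) := by
  have hlead : E / γ * ∑ k ∈ Finset.Icc 1 (n + 1), deriv (c k) x / E ^ k =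
      -deriv U x - ∑ k ∈ Finset.Icc 1 n, γ * c k x / E ^ k -
        ∑ k ∈ Finset.Icc 1 n, (∑ l ∈ Finset.Icc 1 (k - 1), deriv (c l) x * c (k - l) x) / E ^ k := by
    rw [sum_Icc_succ_eq, mul_add, Finset.mul_sum, (h.first x).deriv, sub_sub,
      ← Finset.sum_add_distrib, sub_eq_add_neg, ← Finset.sum_neg_distrib]
    congr 1
    · field_simp
    · refine Finset.sum_congr rfl fun k hk => ?_
      rw [(h.step k (Finset.mem_Icc.1 hk).1 x).deriv]
      field_simp
      ring
  have hlow : ∑ p ∈ Finset.Icc 1 (n + 1) ×ˢ Finset.Icc 1 (n + 1) with ¬ n + 1 ≤ p.1 + p.2,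
        deriv (c p.1) x / E ^ p.1 * (c p.2 x / E ^ p.2) =
      ∑ k ∈ Finset.Icc 1 n,
        (∑ l ∈ Finset.Icc 1 (k - 1), deriv (c l) x * c (k - l) x) / E ^ k := by
    simp_rw [Finset.sum_div]
    rw [Finset.sum_sigma' (Finset.Icc 1 n) (fun k => Finset.Icc 1 (k - 1))
      (fun k l => deriv (c l) x * c (k - l) x / E ^ k)]
    refine Finset.sum_nbij' (fun p => ⟨p.1 + p.2, p.1⟩) (fun q => (q.2, q.1 - q.2)) ?_ ?_ ?_ ?_ ?_
    · rintro ⟨j, l⟩ hp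
      simp only [Finset.mem_filter, Finset.mem_product, Finset.mem_Icc, Finset.mem_sigma] at hp ⊢
      omega
    · rintro ⟨k, l⟩ hp
      simp only [Finset.mem_filter, Finset.mem_product, Finset.mem_Icc, Finset.mem_sigma] at hp ⊢
      omega
    · rintro ⟨j, l⟩ hp
      simp
    · rintro ⟨k, l⟩ hp
      simp only [Finset.mem_Icc, Finset.mem_sigma] at hp
      simp only [Sigma.mk.injEq, heq_eq_eq, and_true]
      omega
    · rintro ⟨j, l⟩ hp
      simp only [Nat.add_sub_cancel_left]
      rw [pow_add]
      field_simp
  have hprod : (∑ k ∈ Finset.Icc 1 (n + 1), c k x / E ^ k) *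
      ∑ k ∈ Finset.Icc 1 (n + 1), deriv (c k) x / E ^ k =
      ∑ p ∈ Finset.Icc 1 (n + 1) ×ˢ Finset.Icc 1 (n + 1),
        deriv (c p.1) x / E ^ p.1 * (c p.2 x / E ^ p.2) := by
    rw [mul_comm, Finset.sum_mul_sum, Finset.sum_product]
  have hlast : ∑ k ∈ Finset.Icc 1 (n + 1), c k x / E ^ k =
      ∑ k ∈ Finset.Icc 1 n, c k x / E ^ k + c (n + 1) x / E ^ (n + 1) :=
    Finset.sum_Icc_succ_top (by omega) _
  rw [← Finset.sum_filter_add_sum_filter_not _ (fun p : ℕ × ℕ => n + 1 ≤ p.1 + p.2), hlow] at hprod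
  have h1 : γ * (E / γ) = E := by field_simp
  have h2 : ∑ k ∈ Finset.Icc 1 n, γ * c k x / E ^ k = γ * ∑ k ∈ Finset.Icc 1 n, c k x / E ^ k := by
    rw [Finset.mul_sum]
    exact Finset.sum_congr rfl fun k _ => by ring
  rw [h2] at hlead
  rw [truncatedCycle, add_mul, hprod, hlead, mul_add, h1, hlast]
  ring

theorem exists_abs_residual_le (h : IsCoeffSequence γ U c) (hγ : 0 < γ) (hc : Continuous (deriv U))
    (n : ℕ) : ∃ C, 0 < C ∧ ∀ E, 1 ≤ E → ∀ x,
      |truncatedCycle γ c (n + 1) E x * (∑ k ∈ Finset.Icc 1 (n + 1), deriv (c k) x / E ^ k) +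
        γ * truncatedCycle γ c (n + 1) E x - E + deriv U x| ≤ C / E ^ (n + 1) := by
  obtain ⟨B, hB, hb⟩ := h.exists_bound hc (n + 1)
  set S := {p ∈ Finset.Icc 1 (n + 1) ×ˢ Finset.Icc 1 (n + 1) | n + 1 ≤ p.1 + p.2}
  refine ⟨γ * B + S.card * (B * B), by positivity, fun E hE x => ?_⟩
  have hE0 : 0 < E := one_pos.trans_le hE
  rw [truncatedCycle_residual h hγ.ne' n hE0.ne' x, add_div]
  refine (abs_add_le _ _).trans (add_le_add ?_ ?_)
  · rw [abs_div, abs_mul, abs_of_pos hγ, abs_of_pos (pow_pos hE0 _)]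
    gcongr
    exact (hb (n + 1) (by omega) le_rfl x).1
  · refine (Finset.abs_sum_le_sum_abs _ _).trans ?_
    rw [mul_div_assoc, ← nsmul_eq_mul]
    refine Finset.sum_le_card_nsmul _ _ _ fun p hp => ?_
    simp only [Finset.mem_filter, Finset.mem_product, Finset.mem_Icc] at hp
    rw [abs_mul, abs_div, abs_div, abs_of_pos (pow_pos hE0 p.1), abs_of_pos (pow_pos hE0 p.2),
      div_mul_div_comm, ← pow_add]
    exact div_le_div₀ (by positivity) (mul_le_mul (hb p.1 hp.1.1.1 hp.1.1.2 x).2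
      (hb p.2 hp.1.2.1 hp.1.2.2 x).1 (abs_nonneg _) hB.le) (by positivity)
      (pow_le_pow_right₀ hE hp.2)

/-- Stability of a cycle: an approximate periodic solution `p` with residual at most `r` is within
`(r / γ) (b / a)` of it. At the extrema of the periodic function `v² - p²` the difference `v - p`
is the residual divided by `-γ`. -/
theorem IsCycle.abs_sub_le {E : ℝ} {v p p' : ℝ → ℝ} {a b r : ℝ} (h : IsCycle γ U E v)
    (hγ : 0 < γ) (hp : Function.Periodic p (2 * π)) (hd : ∀ x, HasDerivAt p (p' x) x)
    (hr : ∀ x, |p x * p' x + γ * p x - E + deriv U x| ≤ r) (ha : 0 < a)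
    (hal : ∀ x, a ≤ v x + p x) (hbu : ∀ x, v x + p x ≤ b) (x : ℝ) :
    |v x - p x| ≤ r / γ * (b / a) := by
  have hr0 : 0 ≤ r := (abs_nonneg _).trans (hr 0)
  have hDp : Function.Periodic (fun x => v x ^ 2 - p x ^ 2) (2 * π) := fun x => by
    simp only [h.periodic x, hp x]
  have hDd : ∀ x, HasDerivAt (fun x => v x ^ 2 - p x ^ 2)
      (-2 * (γ * (v x - p x) + (p x * p' x + γ * p x - E + deriv U x))) x := fun x => by
    have h2 := h.ne_zero x
    refine (((h.ode x).pow 2).sub ((hd x).pow 2)).congr_deriv ?_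
    field_simp
    ring
  have key : ∀ y, -2 * (γ * (v y - p y) + (p y * p' y + γ * p y - E + deriv U y)) = 0 →
      |v y ^ 2 - p y ^ 2| ≤ r / γ * b := by
    intro y hy
    have h1 : |γ * (v y - p y)| ≤ r := by
      have : γ * (v y - p y) = -(p y * p' y + γ * p y - E + deriv U y) := by linarith
      rw [this, abs_neg]
      exact hr y
    rw [abs_mul, abs_of_pos hγ] at h1
    have h2 : |v y - p y| ≤ r / γ := by rwa [le_div_iff₀ hγ, mul_comm]
    rw [show v y ^ 2 - p y ^ 2 = (v y - p y) * (v y + p y) by ring, abs_mul,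
      abs_of_pos (ha.trans_le (hal y))]
    exact mul_le_mul h2 (hbu y) (ha.le.trans (hal y)) (by positivity)
  obtain ⟨x₀, hx₀, h0⟩ := hDp.exists_max_hasDerivAt two_pi_ne_zero hDd
  obtain ⟨x₁, hx₁, h1⟩ := hDp.exists_min_hasDerivAt two_pi_ne_zero hDd
  have hD : |v x ^ 2 - p x ^ 2| ≤ r / γ * b :=
    abs_le.2 ⟨(abs_le.1 (key x₁ h1)).1.trans (hx₁ x), (hx₀ x).trans (abs_le.1 (key x₀ h0)).2⟩
  rw [← mul_div_assoc, le_div_iff₀ ha]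
  refine le_trans ?_ hD
  rw [show v x ^ 2 - p x ^ 2 = (v x - p x) * (v x + p x) by ring, abs_mul,
    abs_of_pos (ha.trans_le (hal x))]
  exact mul_le_mul_of_nonneg_left (hal x) (abs_nonneg _)

theorem IsCycle.integral_eq {E : ℝ} {v : ℝ → ℝ} (h : IsCycle γ U E v) (hγ : 0 < γ)
    (hd : Differentiable ℝ U) (hp : Function.Periodic U (2 * π)) :
    ∫ x in (0 : ℝ)..(2 * π), v x = 2 * π * (E / γ) := by
  have h1 := Function.Periodic.integral_deriv_eq_zero (f := fun x => v x ^ 2 / 2 + U x)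
    (f' := fun x => -γ * v x + E) (c := 2 * π)
    (fun x => by simp only [h.periodic x, hp x]) (fun x => by
      have h2 := h.ne_zero x
      refine ((((h.ode x).pow 2).div_const 2).add (hd x).hasDerivAt).congr_deriv ?_
      field_simp
      ring) ((continuous_const.mul h.continuous).add continuous_const)
  have i1 : IntervalIntegrable (fun x => -γ * v x) volume 0 (2 * π) :=
    (continuous_const.mul h.continuous).intervalIntegrable _ _
  rw [intervalIntegral.integral_add i1 (by simp), intervalIntegral.integral_const_mul,
    intervalIntegral.integral_const, smul_eq_mul] at h1
  field_simp
  linarith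

/-- The truncation of order `N` approximates the cycle up to `O(E⁻ᴺ)`. -/
theorem exists_abs_sub_truncatedCycle_le (h : IsCoeffSequence γ U c) (hγ : 0 < γ)
    (hc : Continuous (deriv U)) (hp : Function.Periodic U (2 * π)) (n : ℕ) :
    ∃ C E₀ : ℝ, 1 ≤ E₀ ∧ ∀ E, E₀ ≤ E → ∀ v, IsCycle γ U E v →
      ∀ x, |v x - truncatedCycle γ c (n + 1) E x| ≤ C / E ^ (n + 1) := by
  obtain ⟨C, hC, hres⟩ := exists_abs_residual_le h hγ hc n
  obtain ⟨B, hB, hb⟩ := h.exists_bound hc (n + 1)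
  obtain ⟨A, hA, ha⟩ := hp.deriv_periodic.exists_forall_abs_le two_pi_ne_zero hc
  refine ⟨C / γ * 8, 1 + 2 * A + γ * ((n + 1) * B), ?_, fun E hE v hv x => ?_⟩
  · have hnB : 0 ≤ γ * ((n + 1) * B) := by positivity
    linarith
  have hnB : 0 ≤ γ * ((n + 1) * B) := by positivity
  have hE1 : 1 ≤ E := by linarith
  have hE0 : 0 < E := by linarith
  have hp1 : ∀ x, |truncatedCycle γ c (n + 1) E x - E / γ| ≤ (n + 1) * B := by
    intro x
    rw [truncatedCycle, add_sub_cancel_left]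
    refine (Finset.abs_sum_le_sum_abs _ _).trans ?_
    have h1 : ∀ k ∈ Finset.Icc 1 (n + 1), |c k x / E ^ k| ≤ B := fun k hk => by
      have hk := Finset.mem_Icc.1 hk
      rw [abs_div, abs_of_pos (pow_pos hE0 k)]
      exact (div_le_self (abs_nonneg _) (one_le_pow₀ hE1)).trans (hb k hk.1 hk.2 x).1
    have h2 := Finset.sum_le_card_nsmul _ _ _ h1
    simpa using h2
  have hBE : (n + 1) * B ≤ E / γ := by
    rw [le_div_iff₀ hγ]; linarith
  have hvl := hv.le_of_forall_le hγ (a := E / 2) (fun x => by linarith [le_of_abs_le (ha x)])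
  have hvu := hv.ge_of_forall_ge hγ (b := 2 * E) (fun x => by linarith [neg_le_of_abs_le (ha x)])
  have h1 := hv.abs_sub_le hγ (periodic_truncatedCycle h (n + 1) E)
    (hasDerivAt_truncatedCycle h (n + 1) E) (hres E hE1) (a := E / 2 / γ) (b := 4 * E / γ)
    (by positivity) (fun x => by linarith [hvl x, neg_le_of_abs_le (hp1 x)])
    (fun x => by
      have : 4 * E / γ = 2 * E / γ + E / γ + E / γ := by ring
      linarith [hvu x, le_of_abs_le (hp1 x)]) x
  refine h1.trans (le_of_eq ?_)
  field_simp
  norm_num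

/-- The remainder of order `N` is bounded by the approximation of order `N + 1`; it has zero average
because the average of the cycle is `E / γ`. -/
theorem hasLargeFieldExpansion_of_isCycle (h : IsCoeffSequence γ U c) (hγ : 0 < γ)
    (hd : Differentiable ℝ U) (hc : Continuous (deriv U)) (hp : Function.Periodic U (2 * π))
    {w : ℝ → ℝ → ℝ} {E₁ : ℝ} (hw : ∀ E, E₁ ≤ E → IsCycle γ U E (w E)) :
    HasLargeFieldExpansion γ c w := by
  intro N hN
  obtain ⟨C, E₀, hE₀, hC⟩ := exists_abs_sub_truncatedCycle_le h hγ hc hp N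
  obtain ⟨B, hB, hb⟩ := h.exists_bound hc (N + 1)
  refine ⟨B + C, max E₀ E₁, by positivity, fun E hE => ?_⟩
  have hE0 : 0 < E := by linarith [le_max_left E₀ E₁]
  have hv := hw E ((le_max_right _ _).trans hE)
  have hpc : Continuous (truncatedCycle γ c N E) :=
    continuous_of_forall_hasDerivAt (hasDerivAt_truncatedCycle h N E)
  refine ⟨fun x => E ^ (N + 1) * (w E x - truncatedCycle γ c N E x),
    continuous_const.mul (hv.continuous.sub hpc), fun x => ?_, ?_, fun x => ?_, fun x => ?_⟩
  · simp only [hv.periodic x, periodic_truncatedCycle h N E x]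
  · have hk : ∀ k ∈ Finset.Icc 1 N,
        IntervalIntegrable (fun x => c k x / E ^ k) volume 0 (2 * π) := fun k hk =>
      ((h.differentiable (Finset.mem_Icc.1 hk).1).continuous.div_const _).intervalIntegrable _ _
    have h1 : ∫ x in (0 : ℝ)..(2 * π), truncatedCycle γ c N E x = 2 * π * (E / γ) := by
      simp only [truncatedCycle]
      rw [intervalIntegral.integral_add (by simp) ((continuous_finsetSum _ fun k hk =>
          (h.differentiable (Finset.mem_Icc.1 hk).1).continuous.div_const _).intervalIntegrable _ _),
        intervalIntegral.integral_finsetSum hk, intervalIntegral.integral_const,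
        Finset.sum_eq_zero fun k hk => by
          rw [intervalIntegral.integral_div, h.average k (Finset.mem_Icc.1 hk).1, zero_div]]
      simp
    rw [intervalIntegral.integral_const_mul, intervalIntegral.integral_sub
      (hv.continuous.intervalIntegrable _ _) (hpc.intervalIntegrable _ _), h1,
      hv.integral_eq hγ hd hp, sub_self, mul_zero]
  · have h1 := hC E ((le_max_left _ _).trans hE) _ hv x
    have h2 : truncatedCycle γ c (N + 1) E x = truncatedCycle γ c N E x +
        c (N + 1) x / E ^ (N + 1) := by
      rw [truncatedCycle, Finset.sum_Icc_succ_top (by omega), ← add_assoc, truncatedCycle]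
    rw [h2, le_div_iff₀ (pow_pos hE0 _)] at h1
    have h3 : E ^ (N + 1) * (w E x - truncatedCycle γ c N E x) = c (N + 1) x +
        (w E x - (truncatedCycle γ c N E x + c (N + 1) x / E ^ (N + 1))) * E ^ (N + 1) := by
      field_simp
      ring
    simp only [h3]
    refine (abs_add_le _ _).trans (add_le_add (hb (N + 1) (by omega) le_rfl x).1 ?_)
    rwa [abs_mul, abs_of_pos (pow_pos hE0 (N + 1))]
  · rw [mul_div_cancel_left₀ _ (pow_pos hE0 _).ne', ← truncatedCycle]
    ring

end Expansion

/-! ### The mean velocity in large fields -/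

/-- The expansion of `1 / (1 + γ e² q)` with `q = c₁ + c₂ e + c₃ e² + R e³` up to order `e⁷`; the
error is a polynomial in bounded quantities, one of which is `s = (1 + γ e² q)⁻¹`. -/
theorem exists_abs_inv_sub_le (γ B : ℝ) : ∃ C, ∀ c₁ c₂ c₃ R e : ℝ, |c₁| ≤ B → |c₂| ≤ B → |c₃| ≤ B →
    |R| ≤ B → 0 < e → e ≤ B → 1 + γ * e ^ 2 * (c₁ + c₂ * e + c₃ * e ^ 2 + R * e ^ 3) ≠ 0 →
    |(1 + γ * e ^ 2 * (c₁ + c₂ * e + c₃ * e ^ 2 + R * e ^ 3))⁻¹| ≤ B →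
    |(1 + γ * e ^ 2 * (c₁ + c₂ * e + c₃ * e ^ 2 + R * e ^ 3))⁻¹ -
      (1 - γ * e ^ 2 * (c₁ + c₂ * e + c₃ * e ^ 2 + R * e ^ 3) + γ ^ 2 * e ^ 4 * c₁ ^ 2 +
        2 * γ ^ 2 * e ^ 5 * (c₁ * c₂) + γ ^ 2 * e ^ 6 * c₂ ^ 2 + 2 * γ ^ 2 * e ^ 6 * (c₁ * c₃) +
        -γ ^ 3 * e ^ 6 * c₁ ^ 3)| ≤ C * e ^ 7 := by
  let q : ℝ × ℝ × ℝ × ℝ × ℝ × ℝ → ℝ := fun p =>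
    p.1 + p.2.1 * p.2.2.2.2.1 + p.2.2.1 * p.2.2.2.2.1 ^ 2 + p.2.2.2.1 * p.2.2.2.2.1 ^ 3
  -- the error divided by `e⁷`
  let g : ℝ × ℝ × ℝ × ℝ × ℝ × ℝ → ℝ := fun p =>
    γ ^ 2 * (2 * p.1 * p.2.2.2.1 + 2 * p.2.1 * p.2.2.1 +
      (p.2.2.1 ^ 2 + 2 * p.2.1 * p.2.2.2.1) * p.2.2.2.2.1 +
      2 * p.2.2.1 * p.2.2.2.1 * p.2.2.2.2.1 ^ 2 + p.2.2.2.1 ^ 2 * p.2.2.2.2.1 ^ 3) -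
    γ ^ 3 * ((p.2.1 + p.2.2.1 * p.2.2.2.2.1 + p.2.2.2.1 * p.2.2.2.2.1 ^ 2) *
      (q p ^ 2 + q p * p.1 + p.1 ^ 2)) +
    γ ^ 4 * p.2.2.2.2.1 * q p ^ 4 * p.2.2.2.2.2
  have hg : Continuous g := by fun_prop
  obtain ⟨C, hC⟩ := (isCompact_closedBall (0 : ℝ × ℝ × ℝ × ℝ × ℝ × ℝ) B).exists_bound_of_continuousOn
    hg.continuousOn
  refine ⟨C, fun c₁ c₂ c₃ R e h₁ h₂ h₃ hR he heB hne hs => ?_⟩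
  set s := (1 + γ * e ^ 2 * (c₁ + c₂ * e + c₃ * e ^ 2 + R * e ^ 3))⁻¹ with hsdef
  have hmem : (c₁, c₂, c₃, R, e, s) ∈ Metric.closedBall (0 : ℝ × ℝ × ℝ × ℝ × ℝ × ℝ) B := by
    rw [mem_closedBall_zero_iff]
    simp only [Prod.norm_def, sup_le_iff, Real.norm_eq_abs]
    exact ⟨h₁, h₂, h₃, hR, by rwa [abs_of_pos he], hs⟩
  have hb := hC _ hmem
  have hs1 : s * (1 + γ * e ^ 2 * (c₁ + c₂ * e + c₃ * e ^ 2 + R * e ^ 3)) = 1 :=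
    inv_mul_cancel₀ hne
  have hkey : s - (1 - γ * e ^ 2 * (c₁ + c₂ * e + c₃ * e ^ 2 + R * e ^ 3) + γ ^ 2 * e ^ 4 * c₁ ^ 2 +
        2 * γ ^ 2 * e ^ 5 * (c₁ * c₂) + γ ^ 2 * e ^ 6 * c₂ ^ 2 + 2 * γ ^ 2 * e ^ 6 * (c₁ * c₃) +
        -γ ^ 3 * e ^ 6 * c₁ ^ 3) = g (c₁, c₂, c₃, R, e, s) * e ^ 7 := by
    have h4 : s = 1 - γ * e ^ 2 * (c₁ + c₂ * e + c₃ * e ^ 2 + R * e ^ 3) +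
        (γ * e ^ 2 * (c₁ + c₂ * e + c₃ * e ^ 2 + R * e ^ 3)) ^ 2 -
        (γ * e ^ 2 * (c₁ + c₂ * e + c₃ * e ^ 2 + R * e ^ 3)) ^ 3 +
        (γ * e ^ 2 * (c₁ + c₂ * e + c₃ * e ^ 2 + R * e ^ 3)) ^ 4 * s := by
      generalize γ * e ^ 2 * (c₁ + c₂ * e + c₃ * e ^ 2 + R * e ^ 3) = y at hs1
      linear_combination (1 - y + y ^ 2 - y ^ 3) * hs1
    simp only [g, q]
    linear_combination h4
  rw [hkey, abs_mul, abs_of_pos (pow_pos he 7)]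
  exact mul_le_mul_of_nonneg_right hb (pow_pos he 7).le

section MeanVelocity

variable {γ : ℝ} {U : ℝ → ℝ} {c : ℕ → ℝ → ℝ}

/-- `c₁ c₂` is a derivative, because `c₂' = -γ² c₁`. -/
theorem IsCoeffSequence.integral_mul_eq_zero (h : IsCoeffSequence γ U c) (hγ : γ ≠ 0) :
    ∫ x in (0 : ℝ)..(2 * π), c 1 x * c 2 x = 0 := by
  refine Function.Periodic.integral_deriv_eq_zero (f := fun x => -(c 2 x ^ 2) / (2 * γ ^ 2))
    (fun x => by simp only [h.periodic 2 (by norm_num) x]) (fun x => ?_)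
    ((h.differentiable le_rfl).continuous.mul (h.differentiable (by norm_num)).continuous)
  refine ((((h.step 1 le_rfl x).pow 2).neg).div_const _).congr_deriv ?_
  simp
  field_simp

/-- The coefficient of `E⁻⁶` in `E ∫ dx / v_E`. It takes the same value on a coefficient sequence
and on the reflected one. -/
noncomputable def sixthCoeff (γ : ℝ) (c : ℕ → ℝ → ℝ) : ℝ :=
  γ ^ 3 * (∫ x in (0 : ℝ)..(2 * π), c 2 x ^ 2) + 2 * γ ^ 3 * (∫ x in (0 : ℝ)..(2 * π), c 1 x * c 3 x) -
    γ ^ 4 * ∫ x in (0 : ℝ)..(2 * π), c 1 x ^ 3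

theorem IsCoeffSequence.integral_sq_reflect (h : IsCoeffSequence γ U c) :
    ∫ x in (0 : ℝ)..(2 * π), ((-1) ^ (1 + 1) * c 1 (-x)) ^ 2 =
      ∫ x in (0 : ℝ)..(2 * π), c 1 x ^ 2 := by
  rw [← Function.Periodic.integral_comp_neg (f := fun x => c 1 x ^ 2)
    (fun x => by simp only [h.periodic 1 le_rfl x])]
  simp

theorem IsCoeffSequence.sixthCoeff_reflect (h : IsCoeffSequence γ U c) :
    sixthCoeff γ (fun k x => (-1) ^ (k + 1) * c k (-x)) = sixthCoeff γ c := by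
  have p1 := h.periodic 1 le_rfl
  have p2 := h.periodic 2 (by norm_num)
  have p3 := h.periodic 3 (by norm_num)
  rw [sixthCoeff, sixthCoeff,
    ← Function.Periodic.integral_comp_neg (f := fun x => c 2 x ^ 2) (fun x => by simp only [p2 x]),
    ← Function.Periodic.integral_comp_neg (f := fun x => c 1 x ^ 3) (fun x => by simp only [p1 x]),
    ← Function.Periodic.integral_comp_neg (f := fun x => c 1 x * c 3 x)
      (fun x => by simp only [p1 x, p3 x])]
  norm_num

/-- The expansion of the period of the cycle, up to the order that distinguishes the two
directions. -/
theorem exists_abs_mul_integral_inv_sub_le (h : IsCoeffSequence γ U c) (hγ : 0 < γ)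
    (hd : Differentiable ℝ U) (hp : Function.Periodic U (2 * π)) {w : ℝ → ℝ → ℝ} {E₁ : ℝ}
    (hw : ∀ E, E₁ ≤ E → IsCycle γ U E (w E)) (hexp : HasLargeFieldExpansion γ c w) :
    ∃ C E₀ : ℝ, 0 < E₀ ∧ ∀ E, E₀ ≤ E →
      |E * (∫ x in (0 : ℝ)..(2 * π), 1 / w E x) - (2 * π * γ +
        γ ^ 3 * (∫ x in (0 : ℝ)..(2 * π), c 1 x ^ 2) / E ^ 4 + sixthCoeff γ c / E ^ 6)| ≤
        C / E ^ 7 := by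
  obtain ⟨A, E₂, hE₂, hA⟩ := hexp 3 (by norm_num)
  have d1 := (h.differentiable (k := 1) le_rfl).continuous
  have d2 := (h.differentiable (k := 2) (by norm_num)).continuous
  have d3 := (h.differentiable (k := 3) (by norm_num)).continuous
  obtain ⟨B1, hB1, hb1⟩ := (h.periodic 1 le_rfl).exists_forall_abs_le two_pi_ne_zero d1
  obtain ⟨B2, hB2, hb2⟩ := (h.periodic 2 (by norm_num)).exists_forall_abs_le two_pi_ne_zero d2
  obtain ⟨B3, hB3, hb3⟩ := (h.periodic 3 (by norm_num)).exists_forall_abs_le two_pi_ne_zero d3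
  set B := 2 + B1 + B2 + B3 + |A| with hB
  have hA0 := abs_nonneg A
  obtain ⟨C, hC⟩ := exists_abs_inv_sub_le γ B
  refine ⟨γ * C * (2 * π), max (max E₁ E₂) (1 + 8 * γ * B), by positivity, fun E hE => ?_⟩
  have hEE1 : E₁ ≤ E := (le_max_left _ _).trans ((le_max_left _ _).trans hE)
  have hEE2 : E₂ ≤ E := (le_max_right _ _).trans ((le_max_left _ _).trans hE)
  have hEE3 : 1 + 8 * γ * B ≤ E := (le_max_right _ _).trans hE
  have hγB : 0 < 8 * γ * B := by positivity
  have hE1 : 1 ≤ E := by linarith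
  have hE0 : 0 < E := by linarith
  have hv := hw E hEE1
  obtain ⟨R, hRc, -, -, hRA, hwR⟩ := hA E hEE2
  have hRB : ∀ x, |R x| ≤ B := fun x => (hRA x).trans (by linarith [le_abs_self A])
  -- pointwise expansion of `E / v`
  have hpt : ∀ x, |E * (1 / w E x) - (2 * γ + -γ ^ 2 / E * w E x + γ ^ 3 / E ^ 4 * c 1 x ^ 2 +
      2 * γ ^ 3 / E ^ 5 * (c 1 x * c 2 x) + γ ^ 3 / E ^ 6 * c 2 x ^ 2 +
      2 * γ ^ 3 / E ^ 6 * (c 1 x * c 3 x) + -γ ^ 4 / E ^ 6 * c 1 x ^ 3)| ≤ γ * C / E ^ 7 := by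
    intro x
    have he : 0 < E⁻¹ := by positivity
    have he1 : E⁻¹ ≤ 1 := inv_le_one_of_one_le₀ hE1
    set q := c 1 x + c 2 x * E⁻¹ + c 3 x * E⁻¹ ^ 2 + R x * E⁻¹ ^ 3 with hq
    have hwq : w E x = E / γ * (1 + γ * E⁻¹ ^ 2 * q) := by
      rw [hwR x, hq]
      simp only [Finset.sum_Icc_succ_top (by norm_num : 1 ≤ 2 + 1),
        Finset.sum_Icc_succ_top (by norm_num : 1 ≤ 1 + 1), Finset.Icc_self, Finset.sum_singleton]
      field_simp
      ring
    have hqB : |q| ≤ 4 * B := by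
      have t1 : |c 1 x| ≤ B := (hb1 x).trans (by linarith)
      have t2 : |c 2 x * E⁻¹| ≤ B := by
        rw [abs_mul, abs_of_pos he]
        exact (mul_le_of_le_one_right (abs_nonneg _) he1).trans ((hb2 x).trans (by linarith))
      have t3 : |c 3 x * E⁻¹ ^ 2| ≤ B := by
        rw [abs_mul, abs_of_pos (pow_pos he 2)]
        exact (mul_le_of_le_one_right (abs_nonneg _) (pow_le_one₀ he.le he1)).trans
          ((hb3 x).trans (by linarith))
      have t4 : |R x * E⁻¹ ^ 3| ≤ B := by
        rw [abs_mul, abs_of_pos (pow_pos he 3)]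
        exact (mul_le_of_le_one_right (abs_nonneg _) (pow_le_one₀ he.le he1)).trans (hRB x)
      have := abs_add_le (c 1 x + c 2 x * E⁻¹ + c 3 x * E⁻¹ ^ 2) (R x * E⁻¹ ^ 3)
      have := abs_add_le (c 1 x + c 2 x * E⁻¹) (c 3 x * E⁻¹ ^ 2)
      have := abs_add_le (c 1 x) (c 2 x * E⁻¹)
      linarith
    have hy : |γ * E⁻¹ ^ 2 * q| ≤ 1 / 2 := by
      rw [abs_mul, abs_of_pos (by positivity : 0 < γ * E⁻¹ ^ 2)]
      calc γ * E⁻¹ ^ 2 * |q| ≤ γ * E⁻¹ ^ 2 * (4 * B) := by gcongr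
        _ = 8 * γ * B * E⁻¹ * E⁻¹ / 2 := by ring
        _ ≤ E * E⁻¹ * E⁻¹ / 2 := by gcongr; linarith
        _ = E⁻¹ / 2 := by field_simp
        _ ≤ 1 / 2 := by linarith
    have hy1 : 1 / 2 ≤ 1 + γ * E⁻¹ ^ 2 * q := by linarith [neg_le_of_abs_le hy]
    have hs : |(1 + γ * E⁻¹ ^ 2 * q)⁻¹| ≤ B := by
      rw [abs_of_pos (by positivity)]
      have : (1 + γ * E⁻¹ ^ 2 * q)⁻¹ ≤ (1 / 2)⁻¹ := inv_anti₀ (by norm_num) hy1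
      rw [show ((1 : ℝ) / 2)⁻¹ = 2 by norm_num] at this
      linarith
    have hfin := hC (c 1 x) (c 2 x) (c 3 x) (R x) E⁻¹ ((hb1 x).trans (by linarith))
      ((hb2 x).trans (by linarith)) ((hb3 x).trans (by linarith)) (hRB x) he (by linarith)
      (by rw [← hq]; positivity) (by rw [← hq]; exact hs)
    rw [← hq] at hfin
    have heq : E * (1 / w E x) - (2 * γ + -γ ^ 2 / E * w E x + γ ^ 3 / E ^ 4 * c 1 x ^ 2 +
        2 * γ ^ 3 / E ^ 5 * (c 1 x * c 2 x) + γ ^ 3 / E ^ 6 * c 2 x ^ 2 +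
        2 * γ ^ 3 / E ^ 6 * (c 1 x * c 3 x) + -γ ^ 4 / E ^ 6 * c 1 x ^ 3) =
        γ * ((1 + γ * E⁻¹ ^ 2 * q)⁻¹ - (1 - γ * E⁻¹ ^ 2 * q + γ ^ 2 * E⁻¹ ^ 4 * c 1 x ^ 2 +
        2 * γ ^ 2 * E⁻¹ ^ 5 * (c 1 x * c 2 x) + γ ^ 2 * E⁻¹ ^ 6 * c 2 x ^ 2 +
        2 * γ ^ 2 * E⁻¹ ^ 6 * (c 1 x * c 3 x) + -γ ^ 3 * E⁻¹ ^ 6 * c 1 x ^ 3)) := by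
      have h1 : E * (1 / w E x) = γ * (1 + γ * E⁻¹ ^ 2 * q)⁻¹ := by
        rw [hwq, one_div, mul_inv, inv_div]
        field_simp
      have h2 : -γ ^ 2 / E * w E x = -γ * (1 + γ * E⁻¹ ^ 2 * q) := by
        rw [hwq]
        field_simp
      rw [h1, h2]
      field_simp
      ring
    rw [heq, abs_mul, abs_of_pos hγ, mul_div_assoc]
    refine mul_le_mul_of_nonneg_left (hfin.trans (le_of_eq ?_)) hγ.le
    rw [inv_pow, div_eq_mul_inv]
  simp only [← Real.norm_eq_abs] at hpt
  have hint := intervalIntegral.norm_integral_le_of_norm_le_const (a := 0) (b := 2 * π)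
    (fun x _ => hpt x)
  have hwc := hv.continuous
  have iI : ∀ {f : ℝ → ℝ}, Continuous f → IntervalIntegrable f volume 0 (2 * π) := fun hf =>
    hf.intervalIntegrable _ _
  have j0 : IntervalIntegrable (fun x => E * (1 / w E x)) volume 0 (2 * π) :=
    iI (continuous_const.mul (continuous_const.div hwc hv.ne_zero))
  rw [intervalIntegral.integral_sub j0 (iI (by fun_prop)),
    intervalIntegral.integral_add (iI (by fun_prop)) (iI (by fun_prop)),
    intervalIntegral.integral_add (iI (by fun_prop)) (iI (by fun_prop)),
    intervalIntegral.integral_add (iI (by fun_prop)) (iI (by fun_prop)),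
    intervalIntegral.integral_add (iI (by fun_prop)) (iI (by fun_prop)),
    intervalIntegral.integral_add (iI (by fun_prop)) (iI (by fun_prop)),
    intervalIntegral.integral_add (iI (by fun_prop)) (iI (by fun_prop)),
    intervalIntegral.integral_const_mul, intervalIntegral.integral_const_mul,
    intervalIntegral.integral_const_mul, intervalIntegral.integral_const_mul,
    intervalIntegral.integral_const_mul, intervalIntegral.integral_const_mul,
    intervalIntegral.integral_const_mul, intervalIntegral.integral_const_mul,
    intervalIntegral.integral_const, hv.integral_eq hγ hd hp, h.integral_mul_eq_zero hγ.ne', Real.norm_eq_abs, sub_zero,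
    abs_of_pos two_pi_pos] at hint
  refine le_trans (le_of_eq ?_) (hint.trans (le_of_eq (by ring)))
  congr 1
  rw [sixthCoeff, smul_eq_mul]
  field_simp
  ring

end MeanVelocity

/-! ### The sign of the current in large fields -/

theorem abs_one_div_pow_six_sub_le {E D : ℝ} (hE : 0 < E) (hD : 2 * |D| ≤ E) :
    |1 / E ^ 6 - 1 / (E + D) ^ 6| ≤ 12288 * |D| / E ^ 7 := by
  have h1 := neg_abs_le D
  have h2 := le_abs_self D
  have hF : E / 2 ≤ E + D := by linarith
  have hF' : E + D ≤ 2 * E := by linarith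
  have hF0 : 0 < E + D := by linarith
  have heq : 1 / E ^ 6 - 1 / (E + D) ^ 6 = D * ((E + D) ^ 5 + (E + D) ^ 4 * E + (E + D) ^ 3 * E ^ 2 +
      (E + D) ^ 2 * E ^ 3 + (E + D) * E ^ 4 + E ^ 5) / (E ^ 6 * (E + D) ^ 6) := by
    field_simp
    ring
  rw [heq, abs_div, abs_mul, abs_of_pos (by positivity : 0 < E ^ 6 * (E + D) ^ 6),
    abs_of_pos (by positivity : 0 < (E + D) ^ 5 + (E + D) ^ 4 * E + (E + D) ^ 3 * E ^ 2 +
      (E + D) ^ 2 * E ^ 3 + (E + D) * E ^ 4 + E ^ 5)]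
  -- all factors are estimated by `E / 2 ≤ E + D ≤ 2 E`, so that `12288 = 6 * 2 ^ 5 * 2 ^ 6`
  calc |D| * ((E + D) ^ 5 + (E + D) ^ 4 * E + (E + D) ^ 3 * E ^ 2 +
      (E + D) ^ 2 * E ^ 3 + (E + D) * E ^ 4 + E ^ 5) / (E ^ 6 * (E + D) ^ 6)
      ≤ |D| * ((2 * E) ^ 5 + (2 * E) ^ 4 * (2 * E) + (2 * E) ^ 3 * (2 * E) ^ 2 +
      (2 * E) ^ 2 * (2 * E) ^ 3 + (2 * E) * (2 * E) ^ 4 + (2 * E) ^ 5) / (E ^ 6 * (E / 2) ^ 6) := by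
        gcongr <;> linarith
    _ = _ := by field_simp; ring

theorem sq_div_le_mul_one_div_pow_four_sub {E D : ℝ} (hE : 0 < E) (hD : 2 * |D| ≤ E) :
    D ^ 2 / (16 * E ^ 5) ≤ D * (1 / E ^ 4 - 1 / (E + D) ^ 4) := by
  have h1 := neg_abs_le D
  have h2 := le_abs_self D
  have hF' : E + D ≤ 2 * E := by linarith
  have hF0 : 0 < E + D := by linarith
  have heq : D * (1 / E ^ 4 - 1 / (E + D) ^ 4) =
      D ^ 2 * ((2 * E + D) * ((E + D) ^ 2 + E ^ 2)) / (E ^ 4 * (E + D) ^ 4) := by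
    field_simp
    ring
  rw [heq]
  calc D ^ 2 / (16 * E ^ 5) = D ^ 2 * (E * (0 + E ^ 2)) / (E ^ 4 * (2 * E) ^ 4) := by
        field_simp; ring
    _ ≤ _ := by
        have h3 : 0 < 2 * E + D := by linarith
        gcongr
        · linarith
        · positivity

/-- If the leading term of `B` has the sign of `Δ` and the error is of higher order, then `B` has
the sign of `Δ` in large fields. -/
theorem mul_pos_of_abs_sub_le {B C E I Δ : ℝ} (hI : 0 < I) (hΔ : Δ ≠ 0) (hE1 : 1 ≤ E)
    (hEΔ : 2 * |Δ| ≤ E) (hEC : 16 * |C| / (I * |Δ|) < E)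
    (hB : |B - (1 / E ^ 4 - 1 / (E + Δ) ^ 4) * I| ≤ C / E ^ 7) : 0 < Δ * B := by
  have hE0 : 0 < E := by linarith
  have hΔ0 : 0 < |Δ| := abs_pos.2 hΔ
  have h1 := sq_div_le_mul_one_div_pow_four_sub hE0 hEΔ
  have h2 : |Δ * (B - (1 / E ^ 4 - 1 / (E + Δ) ^ 4) * I)| ≤ |Δ| * (|C| / E ^ 7) := by
    rw [abs_mul]
    refine mul_le_mul_of_nonneg_left (hB.trans ?_) hΔ0.le
    gcongr
    exact le_abs_self _
  have h3 := neg_le_of_abs_le h2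
  have h4 := mul_le_mul_of_nonneg_right h1 hI.le
  have h5 : |Δ| * (|C| / E ^ 7) < Δ ^ 2 / (16 * E ^ 5) * I := by
    rw [div_lt_iff₀ (by positivity)] at hEC
    have h6 : 16 * |C| < E ^ 2 * (I * |Δ|) :=
      hEC.trans_le (mul_le_mul_of_nonneg_right (by nlinarith) (by positivity))
    rw [← sq_abs Δ]
    have h7 : |Δ| ^ 2 / (16 * E ^ 5) * I - |Δ| * (|C| / E ^ 7) =
        |Δ| * (E ^ 2 * (I * |Δ|) - 16 * |C|) / (16 * E ^ 7) := by
      field_simp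
    have h8 : 0 < |Δ| * (E ^ 2 * (I * |Δ|) - 16 * |C|) / (16 * E ^ 7) := by
      have := sub_pos.2 h6
      positivity
    linarith
  linarith [mul_sub Δ B ((1 / E ^ 4 - 1 / (E + Δ) ^ 4) * I),
    mul_assoc Δ (1 / E ^ 4 - 1 / (E + Δ) ^ 4) I]

theorem meanVelocity_eq (v : ℝ → ℝ) :
    meanVelocity v = 2 * π / ∫ x in (0 : ℝ)..(2 * π), 1 / v x := (div_eq_mul_inv _ _).symm

section LargeField

variable {γ : ℝ} {U : ℝ → ℝ}

theorem IsCycle.integral_inv_pos {E : ℝ} {v : ℝ → ℝ} (h : IsCycle γ U E v) (hpos : ∀ x, 0 < v x) :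
    0 < ∫ x in (0 : ℝ)..(2 * π), 1 / v x :=
  intervalIntegral.intervalIntegral_pos_of_pos
    ((continuous_const.div h.continuous h.ne_zero).intervalIntegrable _ _)
    (fun x => one_div_pos.2 (hpos x)) two_pi_pos

theorem meanVelocity_pos {E : ℝ} {v : ℝ → ℝ} (h : IsCycle γ U E v) (hpos : ∀ x, 0 < v x) :
    0 < meanVelocity v :=
  mul_pos two_pi_pos (inv_pos.2 (h.integral_inv_pos hpos))

theorem meanVelocity_cycle_neg {E : ℝ} (h : IsCycle γ U (-E) (cycle γ U (-E))) :
    meanVelocity (cycle γ U (-E)) = -meanVelocity (reflCycle γ U E) := by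
  have h1 : ∫ x in (0 : ℝ)..(2 * π), 1 / reflCycle γ U E x =
      -∫ x in (0 : ℝ)..(2 * π), 1 / cycle γ U (-E) x := by
    rw [← Function.Periodic.integral_comp_neg (f := fun x => 1 / cycle γ U (-E) x)
      (fun x => by simp only [h.periodic x]), ← intervalIntegral.integral_neg]
    simp only [reflCycle, div_neg]
  rw [meanVelocity, meanVelocity, h1, inv_neg]
  ring

/-- The difference of the two rescaled periods, which carries the sign of the current. -/
theorem exists_abs_period_sub_le (hγ : 0 < γ) (hd : Differentiable ℝ U) (hc : Continuous (deriv U))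
    (hp : Function.Periodic U (2 * π)) (Δ : ℝ) :
    ∃ C E₀ : ℝ, 0 < E₀ ∧ ∀ E, E₀ ≤ E →
      |E * (∫ x in (0 : ℝ)..(2 * π), 1 / reflCycle γ U E x) -
        (E + Δ) * (∫ x in (0 : ℝ)..(2 * π), 1 / cycle γ U (E + Δ) x) -
        (1 / E ^ 4 - 1 / (E + Δ) ^ 4) *
          (γ ^ 3 * ∫ x in (0 : ℝ)..(2 * π), cycleCoeff γ U 1 x ^ 2)| ≤ C / E ^ 7 := by
  obtain ⟨A, hA, ha⟩ := hp.deriv_periodic.exists_forall_abs_le two_pi_ne_zero hc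
  have hs := isCoeffSequence_cycleCoeff (γ := γ) hd hc hp
  have hcyc : ∀ E, A + 1 ≤ E → IsCycle γ U E (cycle γ U E) := fun E hE =>
    isCycle_cycle_of_lt hγ hc hp fun x => by linarith [le_of_abs_le (ha x)]
  have hrefl : ∀ E, A + 1 ≤ E → IsCycle γ (reflPot U) E (reflCycle γ U E) := fun E hE =>
    isCycle_reflCycle hγ hc hp fun x => by linarith [neg_le_of_abs_le (ha x)]
  have hd' : Differentiable ℝ (reflPot U) := hd.comp differentiable_neg
  obtain ⟨C₁, E₁, hE₁, h₁⟩ := exists_abs_mul_integral_inv_sub_le hs hγ hd hp hcyc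
    (hasLargeFieldExpansion_of_isCycle hs hγ hd hc hp hcyc)
  obtain ⟨C₂, E₂, hE₂, h₂⟩ := exists_abs_mul_integral_inv_sub_le hs.reflect hγ hd'
    (periodic_reflPot hp) hrefl
    (hasLargeFieldExpansion_of_isCycle hs.reflect hγ hd' (continuous_deriv_reflPot hc)
      (periodic_reflPot hp) hrefl)
  rw [hs.sixthCoeff_reflect, hs.integral_sq_reflect] at h₂
  set I := ∫ x in (0 : ℝ)..(2 * π), cycleCoeff γ U 1 x ^ 2
  set b := sixthCoeff γ (cycleCoeff γ U)
  refine ⟨C₂ + |C₁| * 128 + |b| * (12288 * |Δ|), E₁ + E₂ + 2 * |Δ|, by positivity,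
    fun E hE => ?_⟩
  have hΔ := abs_nonneg Δ
  have hΔ1 := neg_abs_le Δ
  have hE0 : 0 < E := by linarith
  have e2 := h₂ E (by linarith)
  have e1 := h₁ (E + Δ) (by linarith)
  have e1' : C₁ / (E + Δ) ^ 7 ≤ |C₁| * 128 / E ^ 7 := by
    calc C₁ / (E + Δ) ^ 7 ≤ |C₁| / (E / 2) ^ 7 := by
          have : 0 < E + Δ := by linarith
          gcongr
          · exact le_abs_self _
          · linarith
      _ = _ := by field_simp; ring
  have e3 := mul_le_mul_of_nonneg_left
    (abs_one_div_pow_six_sub_le hE0 (by linarith : 2 * |Δ| ≤ E)) (abs_nonneg b)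
  rw [← abs_mul] at e3
  have e4 := abs_add_le
    (E * (∫ x in (0 : ℝ)..(2 * π), 1 / reflCycle γ U E x) -
      (2 * π * γ + γ ^ 3 * I / E ^ 4 + b / E ^ 6) -
      ((E + Δ) * (∫ x in (0 : ℝ)..(2 * π), 1 / cycle γ U (E + Δ) x) -
      (2 * π * γ + γ ^ 3 * I / (E + Δ) ^ 4 + b / (E + Δ) ^ 6)))
    (b * (1 / E ^ 6 - 1 / (E + Δ) ^ 6))
  have e5 := abs_sub (E * (∫ x in (0 : ℝ)..(2 * π), 1 / reflCycle γ U E x) -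
      (2 * π * γ + γ ^ 3 * I / E ^ 4 + b / E ^ 6))
      ((E + Δ) * (∫ x in (0 : ℝ)..(2 * π), 1 / cycle γ U (E + Δ) x) -
      (2 * π * γ + γ ^ 3 * I / (E + Δ) ^ 4 + b / (E + Δ) ^ 6))
  have e6 : (C₂ + |C₁| * 128 + |b| * (12288 * |Δ|)) / E ^ 7 =
      C₂ / E ^ 7 + |C₁| * 128 / E ^ 7 + |b| * (12288 * |Δ| / E ^ 7) := by ring
  rw [e6]
  refine le_trans (le_of_eq ?_) (e4.trans (by linarith))
  congr 1
  ring

/-- The value `(E₂ V_{E₁} + E₁ V_{-E₂}) / (E₁ + E₂)` of the current in terms of the periods of the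
cycles. -/
theorem current_value_eq {E Δ : ℝ} (h₁ : IsCycle γ U (E + Δ) (cycle γ U (E + Δ)))
    (h₁pos : ∀ x, 0 < cycle γ U (E + Δ) x) (h₂ : IsCycle γ U (-E) (cycle γ U (-E)))
    (h₂neg : ∀ x, cycle γ U (-E) x < 0) :
    (E * meanVelocity (cycle γ U (E + Δ)) + (E + Δ) * meanVelocity (cycle γ U (-E))) /
        (2 * E + Δ) =
      meanVelocity (cycle γ U (E + Δ)) * meanVelocity (reflCycle γ U E) / (2 * π * (2 * E + Δ)) *
        (E * (∫ x in (0 : ℝ)..(2 * π), 1 / reflCycle γ U E x) -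
          (E + Δ) * (∫ x in (0 : ℝ)..(2 * π), 1 / cycle γ U (E + Δ) x)) := by
  have t₁ := h₁.integral_inv_pos h₁pos
  have h₂' := h₂.reflect
  rw [neg_neg] at h₂'
  have t₂ : 0 < ∫ x in (0 : ℝ)..(2 * π), 1 / reflCycle γ U E x :=
    h₂'.integral_inv_pos fun x => neg_pos.2 (h₂neg _)
  rw [meanVelocity_cycle_neg h₂, meanVelocity_eq, meanVelocity_eq]
  generalize (∫ x in (0 : ℝ)..(2 * π), 1 / reflCycle γ U E x) = s at t₂
  generalize (∫ x in (0 : ℝ)..(2 * π), 1 / cycle γ U (E + Δ) x) = t at t₁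
  have := pi_pos
  rcases eq_or_ne (2 * E + Δ) 0 with h0 | h0
  · simp [h0]
  · field_simp
    ring

theorem IsCoeffSequence.integral_sq_pos {c : ℕ → ℝ → ℝ} (h : IsCoeffSequence γ U c) (hγ : γ ≠ 0)
    (hd : Differentiable ℝ U) (hnc : ¬ ∃ a : ℝ, ∀ x, U x = a) :
    0 < ∫ x in (0 : ℝ)..(2 * π), c 1 x ^ 2 := by
  have hc := (h.differentiable (k := 1) le_rfl).continuous
  refine intervalIntegral.integral_pos two_pi_pos (hc.pow 2).continuousOn
    (fun x _ => sq_nonneg _) ?_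
  by_contra! hcon
  apply hnc
  have h0 : ∀ x, c 1 x = 0 := fun x => by
    obtain ⟨y, hy, hxy⟩ := (h.periodic 1 le_rfl).exists_mem_Ico₀ two_pi_pos x
    rw [hxy]
    exact pow_eq_zero_iff two_ne_zero |>.1
      (le_antisymm (hcon y (Set.Ico_subset_Icc_self hy)) (sq_nonneg _))
  refine ⟨U 0, fun x => is_const_of_deriv_eq_zero hd (fun y => ?_) x 0⟩
  have h1 := (h.first y).deriv
  rw [funext h0, deriv_const] at h1
  simpa [hγ] using h1.symm

/-- For a potential of zero average the first coefficient is `-γ U`. -/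
theorem IsCoeffSequence.first_eq {c : ℕ → ℝ → ℝ} (h : IsCoeffSequence γ U c)
    (hd : Differentiable ℝ U) (h0 : ∫ x in (0 : ℝ)..(2 * π), U x = 0) (x : ℝ) :
    c 1 x = -γ * U x := by
  have hc := h.differentiable (k := 1) le_rfl
  have hconst : ∀ y, c 1 y + γ * U y = c 1 0 + γ * U 0 := fun y =>
    is_const_of_deriv_eq_zero (hc.add (hd.const_mul γ)) (fun z => by
      rw [((h.first z).add ((hd z).hasDerivAt.const_mul γ)).deriv]; ring) y 0
  have hint : ∫ y in (0 : ℝ)..(2 * π), (c 1 y + γ * U y) = 0 := by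
    have i2 : IntervalIntegrable (fun y => γ * U y) volume 0 (2 * π) :=
      (continuous_const.mul hd.continuous).intervalIntegrable _ _
    rw [intervalIntegral.integral_add (hc.continuous.intervalIntegrable _ _) i2,
      intervalIntegral.integral_const_mul, h0, h.average 1 le_rfl]
    simp
  simp only [hconst, intervalIntegral.integral_const, smul_eq_mul, sub_zero] at hint
  have := (mul_eq_zero.1 hint).resolve_left two_pi_ne_zero
  linarith [hconst x]

end LargeField

/-! ### Trajectories -/

/-- The equation of motion as a first order system for position and velocity. -/
noncomputable def phaseField (γ : ℝ) (U F : ℝ → ℝ) (t : ℝ) (p : ℝ × ℝ) : ℝ × ℝ :=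
  (p.2, F t - γ * p.2 - deriv U p.1)

section Trajectory

variable {γ : ℝ} {U F : ℝ → ℝ} {L : NNReal}

theorem exists_lipschitzWith_deriv (hU : ContDiff ℝ 2 U) (hp : Function.Periodic U (2 * π)) :
    ∃ L, LipschitzWith L (deriv U) := by
  have h1 : ContDiff ℝ 1 (deriv U) := ((contDiff_succ_iff_deriv (n := 1)).1 hU).2.2
  obtain ⟨C, -, hC⟩ := hp.deriv_periodic.deriv_periodic.exists_forall_abs_le two_pi_ne_zero
    (h1.continuous_deriv le_rfl)
  refine ⟨C.toNNReal, lipschitzWith_of_nnnorm_deriv_le (h1.differentiable one_ne_zero) fun x => ?_⟩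
  rw [← NNReal.coe_le_coe, coe_nnnorm, Real.norm_eq_abs]
  exact (hC x).trans (Real.le_coe_toNNReal C)

theorem lipschitzWith_phaseField (hγ : 0 < γ) (hL : LipschitzWith L (deriv U)) (t : ℝ) :
    LipschitzWith (1 + γ.toNNReal + L) (phaseField γ U F t) := by
  refine LipschitzWith.of_dist_le_mul fun p q => ?_
  have h1 : |p.1 - q.1| ≤ dist p q := by rw [← dist_eq]; exact le_max_left _ _
  have h2 : |p.2 - q.2| ≤ dist p q := by rw [← dist_eq]; exact le_max_right _ _
  have h3 := hL.dist_le_mul p.1 q.1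
  rw [dist_eq, dist_eq] at h3
  have h4 : (L : ℝ) * |p.1 - q.1| ≤ L * dist p q := by gcongr
  have h5 : γ * |p.2 - q.2| ≤ γ * dist p q := by gcongr
  have hL0 : 0 ≤ (L : ℝ) * dist p q := by positivity
  have hγ0 : 0 ≤ γ * dist p q := by positivity
  push_cast
  rw [Real.coe_toNNReal _ hγ.le]
  refine max_le ?_ ?_
  · rw [dist_eq]
    change |p.2 - q.2| ≤ _
    linarith [dist_nonneg (x := p) (y := q)]
  · rw [dist_eq]
    change |(F t - γ * p.2 - deriv U p.1) - (F t - γ * q.2 - deriv U q.1)| ≤ _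
    have h6 : (F t - γ * p.2 - deriv U p.1) - (F t - γ * q.2 - deriv U q.1) =
        -(γ * (p.2 - q.2)) - (deriv U p.1 - deriv U q.1) := by ring
    have h7 := abs_sub (-(γ * (p.2 - q.2))) (deriv U p.1 - deriv U q.1)
    rw [abs_neg, abs_mul, abs_of_pos hγ] at h7
    rw [h6]
    linarith [dist_nonneg (x := p) (y := q)]

theorem IsTrajectory.hasDerivAt_phase {x₀ v₀ : ℝ} {X : ℝ → ℝ} (h : IsTrajectory γ U F x₀ v₀ X)
    (t : ℝ) : HasDerivAt (fun t => (X t, deriv X t)) (phaseField γ U F t (X t, deriv X t)) t :=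
  (h.differentiable t).hasDerivAt.prodMk (h.ode t)

theorem existsUnique_isTrajectory (hγ : 0 < γ) (hL : LipschitzWith L (deriv U))
    (hF : Continuous F) {Φ : ℝ} (hΦ : ∀ t, |F t| ≤ Φ) (x₀ v₀ : ℝ) :
    ∃! X : ℝ → ℝ, IsTrajectory γ U F x₀ v₀ X := by
  have hlip := lipschitzWith_phaseField (F := F) hγ hL
  have hcont : Continuous (Function.uncurry (phaseField γ U F)) := by
    have hc := hL.continuous
    unfold phaseField Function.uncurry
    fun_prop
  have hb : ∀ t, ‖phaseField γ U F t 0‖ ≤ Φ + |deriv U 0| := fun t => by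
    have h1 : phaseField γ U F t 0 = (0, F t - deriv U 0) := by simp [phaseField]
    rw [h1, Prod.norm_def, norm_zero, max_eq_right (norm_nonneg _), Real.norm_eq_abs]
    exact (abs_sub _ _).trans (by linarith [hΦ t])
  obtain ⟨y, hy0, hy⟩ := exists_hasDerivAt_of_lipschitzWith hcont hlip hb (x₀, v₀)
  have h1 : ∀ t, HasDerivAt (fun t => (y t).1) (y t).2 t := fun t =>
    (ContinuousLinearMap.fst ℝ ℝ ℝ).hasFDerivAt.comp_hasDerivAt t (hy t)
  have h2 : ∀ t, HasDerivAt (fun t => (y t).2) (F t - γ * (y t).2 - deriv U (y t).1) t := fun t =>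
    (ContinuousLinearMap.snd ℝ ℝ ℝ).hasFDerivAt.comp_hasDerivAt t (hy t)
  have h3 : deriv (fun t => (y t).1) = fun t => (y t).2 := funext fun t => (h1 t).deriv
  refine ⟨fun t => (y t).1, ⟨by simp [hy0], by simp [h3, hy0], fun t => (h1 t).differentiableAt,
    fun t => by rw [h3]; exact h2 t⟩, fun X hX => ?_⟩
  have h4 : (fun t => (X t, deriv X t)) = y :=
    ODE_solution_unique_univ (v := phaseField γ U F) (s := fun _ => Set.univ) (t₀ := 0)
      (fun t => (hlip t).lipschitzOnWith) (fun t => ⟨hX.hasDerivAt_phase t, trivial⟩)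
      (fun t => ⟨hy t, trivial⟩) (by simp only [hX.position, hX.velocity, hy0])
  funext t
  rw [← h4]

theorem isTrajectory_trajectory (hγ : 0 < γ) (hL : LipschitzWith L (deriv U))
    (hF : Continuous F) {Φ : ℝ} (hΦ : ∀ t, |F t| ≤ Φ) (x₀ v₀ : ℝ) :
    IsTrajectory γ U F x₀ v₀ (trajectory γ U F x₀ v₀) :=
  Classical.epsilon_spec (existsUnique_isTrajectory hγ hL hF hΦ x₀ v₀).exists

/-- Continuous dependence on the initial data, needed for the measurability of the drift. -/
theorem continuous_trajectory (hγ : 0 < γ) (hL : LipschitzWith L (deriv U))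
    (hF : Continuous F) {Φ : ℝ} (hΦ : ∀ t, |F t| ≤ Φ) {t : ℝ} (ht : 0 ≤ t) :
    Continuous fun p : ℝ × ℝ => trajectory γ U F p.1 p.2 t := by
  have hlip := lipschitzWith_phaseField (F := F) hγ hL
  have htr := fun p : ℝ × ℝ => isTrajectory_trajectory hγ hL hF hΦ p.1 p.2
  have hph := fun p : ℝ × ℝ => (htr p).hasDerivAt_phase
  refine (LipschitzWith.of_dist_le_mul
    (K := (exp ((1 + γ.toNNReal + L : NNReal) * t)).toNNReal) fun p q => ?_).continuous
  have h1 := dist_le_of_trajectories_ODE (a := 0) (b := t) (δ := dist p q) hlip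
    (fun s _ => (hph p s).continuousAt.continuousWithinAt) (fun s _ => (hph p s).hasDerivWithinAt)
    (fun s _ => (hph q s).continuousAt.continuousWithinAt) (fun s _ => (hph q s).hasDerivWithinAt)
    (by simp only [(htr _).position, (htr _).velocity]; exact le_rfl) t ⟨ht, le_rfl⟩
  rw [Real.coe_toNNReal _ (exp_pos _).le, mul_comm]
  rw [sub_zero] at h1
  exact (le_max_left _ _).trans h1

/-- Friction keeps the velocity bounded in positive time. -/
theorem IsTrajectory.abs_deriv_le {x₀ v₀ Ψ : ℝ} {X : ℝ → ℝ} (h : IsTrajectory γ U F x₀ v₀ X)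
    (hγ : 0 < γ) (hΨ : ∀ t x, |F t - deriv U x| ≤ Ψ) {t : ℝ} (ht : 0 ≤ t) :
    |deriv X t| ≤ |v₀| + (Ψ / γ + 1) := by
  have hcont : Continuous (deriv X) := continuous_of_forall_hasDerivAt h.ode
  have hb : Ψ < γ * (|v₀| + (Ψ / γ + 1)) := by
    have h1 : γ * (|v₀| + (Ψ / γ + 1)) = γ * |v₀| + Ψ + γ := by field_simp; ring
    rw [h1]
    nlinarith [abs_nonneg v₀]
  have hΨ0 : 0 ≤ Ψ / γ := div_nonneg ((abs_nonneg _).trans (hΨ 0 0)) hγ.le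
  rw [abs_le]
  constructor
  · refine image_le_of_deriv_right_lt_deriv_boundary (a := 0) (b := t)
      (f := fun _ => -(|v₀| + (Ψ / γ + 1))) (f' := fun _ => 0)
      continuousOn_const (fun _ _ => hasDerivWithinAt_const _ _ _)
      (by rw [h.velocity]; linarith [neg_abs_le v₀]) h.ode (fun s _ hs => ?_) ⟨ht, le_rfl⟩
    rw [← hs]
    linarith [neg_le_of_abs_le (hΨ s (X s))]
  · refine image_le_of_deriv_right_lt_deriv_boundary (a := 0) (b := t)
      (B := fun _ => |v₀| + (Ψ / γ + 1)) (B' := fun _ => 0)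
      hcont.continuousOn (fun s _ => (h.ode s).hasDerivWithinAt)
      (by rw [h.velocity]; linarith [le_abs_self v₀]) (fun _ => hasDerivAt_const _ _)
      (fun s _ hs => ?_) ⟨ht, le_rfl⟩
    rw [hs]
    linarith [le_of_abs_le (hΨ s (X s))]

theorem IsTrajectory.abs_sub_le {x₀ v₀ Ψ : ℝ} {X : ℝ → ℝ} (h : IsTrajectory γ U F x₀ v₀ X)
    (hγ : 0 < γ) (hΨ : ∀ t x, |F t - deriv U x| ≤ Ψ) {a b : ℝ} (ha : 0 ≤ a) (hab : a ≤ b) :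
    |X b - X a| ≤ (|v₀| + (Ψ / γ + 1)) * (b - a) :=
  norm_image_sub_le_of_norm_deriv_le_segment' (fun s _ => (h.differentiable s).hasDerivAt.hasDerivWithinAt)
    (fun _ hs => h.abs_deriv_le hγ hΨ (ha.trans hs.1)) b ⟨hab, le_rfl⟩

/-- Under a constant force with a cycle, every trajectory moves with the mean velocity of the cycle
up to a bounded error. The deviation `u = X' - v(X)` from the cycle satisfies the linear equation
`u' = -((E - U'(X)) / v(X)) u`, whose rate is bounded below, so it decays exponentially; the error
is measured in the time coordinate `∫ dx / v` along the cycle, whose derivative along the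
trajectory is `1 + u / v(X)`. -/
theorem IsCycle.exists_displacement_bound {E : ℝ} {v : ℝ → ℝ} (hv : IsCycle γ U E v)
    (hc : Continuous (deriv U)) (hp : Function.Periodic (deriv U) (2 * π))
    (hrate : ∀ x, 0 < (E - deriv U x) / v x) (hτ : ∫ x in (0 : ℝ)..(2 * π), 1 / v x ≠ 0) :
    ∃ C, 0 ≤ C ∧ ∀ (F : ℝ → ℝ) (x₀ v₀ : ℝ) (X : ℝ → ℝ), IsTrajectory γ U F x₀ v₀ X →
      ∀ a b, a ≤ b → (∀ t ∈ Set.Icc a b, F t = E) →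
        |X b - X a - meanVelocity v * (b - a)| ≤ C * (1 + |deriv X a|) := by
  have hvc := hv.continuous
  have hic : Continuous fun x => 1 / v x := continuous_const.div hvc hv.ne_zero
  obtain ⟨x₁, hx₁⟩ := Function.Periodic.exists_forall_ge (f := fun x => (E - deriv U x) / v x)
    (fun x => by simp only [hp x, hv.periodic x]) two_pi_ne_zero
    ((continuous_const.sub hc).div hvc hv.ne_zero)
  set a₀ := (E - deriv U x₁) / v x₁
  have ha₀ : 0 < a₀ := hrate x₁
  obtain ⟨B, hB, hb⟩ := hv.periodic.exists_forall_abs_le two_pi_ne_zero hvc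
  obtain ⟨B', hB', hb'⟩ := Function.Periodic.exists_forall_abs_le (f := fun x => 1 / v x)
    (fun x => by simp only [hv.periodic x]) two_pi_ne_zero hic
  set τ := ∫ x in (0 : ℝ)..(2 * π), 1 / v x with hτdef
  set H : ℝ → ℝ := fun x => ∫ y in (0 : ℝ)..x, 1 / v y with hHdef
  have hH : ∀ x, HasDerivAt H (1 / v x) x := fun x => (hic.integral_hasStrictDerivAt 0 x).hasDerivAt
  have hVτ : meanVelocity v * τ = 2 * π := by
    rw [meanVelocity, mul_assoc, inv_mul_cancel₀ hτ, mul_one]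
  -- the time coordinate is linear up to a periodic function
  obtain ⟨B'', hB'', hb''⟩ := Function.Periodic.exists_forall_abs_le
    (f := fun x => meanVelocity v * H x - x) (c := 2 * π) (fun x => by
      have h1 : H (x + 2 * π) = H x + τ := by
        have h2 := Function.Periodic.intervalIntegral_add_eq (f := fun x => 1 / v x)
          (T := 2 * π) (fun x => by simp only [hv.periodic x]) x 0
        rw [zero_add] at h2
        rw [hHdef, hτdef, ← h2]
        exact (intervalIntegral.integral_add_adjacent_intervals (hic.intervalIntegrable _ _)
          (hic.intervalIntegrable _ _)).symm
      simp only [h1, mul_add, hVτ]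
      ring) two_pi_ne_zero
    ((continuous_const.mul (continuous_of_forall_hasDerivAt hH)).sub continuous_id)
  refine ⟨|meanVelocity v| * (B' * (1 + B) / a₀) + 2 * B'', by positivity,
    fun F x₀ v₀ X hX a b hab hF => ?_⟩
  set u : ℝ → ℝ := fun t => deriv X t - v (X t) with hu
  have hud : ∀ t ∈ Set.Icc a b,
      HasDerivAt u (-((E - deriv U (X t)) / v (X t)) * u t) t := fun t ht => by
    have h1 := (hX.ode t).sub ((hv.ode (X t)).comp t (hX.differentiable t).hasDerivAt)
    refine h1.congr_deriv ?_
    have := hv.ne_zero (X t)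
    simp only [hu, hF t ht]
    field_simp
    ring
  -- `u² exp (2 a₀ t)` decreases
  have hdecay : ∀ t ∈ Set.Icc a b, |u t| ≤ |u a| * exp (-a₀ * (t - a)) := by
    intro t ht
    have hgd : ∀ s ∈ Set.Icc a b, HasDerivAt (fun s => u s ^ 2 * exp (2 * a₀ * (s - a)))
        (2 * (a₀ - (E - deriv U (X s)) / v (X s)) * (u s ^ 2 * exp (2 * a₀ * (s - a)))) s := by
      intro s hs
      refine (((hud s hs).pow 2).mul
        ((((hasDerivAt_id' s).sub_const a).const_mul (2 * a₀)).exp)).congr_deriv ?_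
      simp
      ring
    have hanti : AntitoneOn (fun s => u s ^ 2 * exp (2 * a₀ * (s - a))) (Set.Icc a b) := by
      refine antitoneOn_of_hasDerivWithinAt_nonpos (convex_Icc a b)
        (fun s hs => (hgd s hs).continuousAt.continuousWithinAt)
        (fun s hs => (hgd s (interior_subset hs)).hasDerivWithinAt) fun s hs => ?_
      have h1 : a₀ - (E - deriv U (X s)) / v (X s) ≤ 0 := sub_nonpos.2 (hx₁ _)
      exact mul_nonpos_of_nonpos_of_nonneg (by linarith) (by positivity)
    have h1 := hanti ⟨le_rfl, hab⟩ ht ht.1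
    simp only [sub_self, mul_zero, exp_zero, mul_one] at h1
    refine abs_le_of_sq_le_sq ?_ (by positivity)
    rw [mul_pow, sq_abs, ← exp_nat_mul]
    have h2 : exp (2 * a₀ * (t - a)) * exp ((2 : ℕ) * (-a₀ * (t - a))) = 1 := by
      rw [← exp_add, exp_eq_one_iff]; push_cast; ring
    calc u t ^ 2 = u t ^ 2 * (exp (2 * a₀ * (t - a)) * exp ((2 : ℕ) * (-a₀ * (t - a)))) := by
          rw [h2, mul_one]
      _ = u t ^ 2 * exp (2 * a₀ * (t - a)) * exp ((2 : ℕ) * (-a₀ * (t - a))) := by ring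
      _ ≤ _ := mul_le_mul_of_nonneg_right h1 (exp_pos _).le
  have hDd : ∀ t, HasDerivAt (fun t => H (X t) - H (X a) - (t - a)) (u t / v (X t)) t := fun t => by
    have h1 := (((hH (X t)).comp t (hX.differentiable t).hasDerivAt).sub_const (H (X a))).sub
      ((hasDerivAt_id' t).sub_const a)
    refine h1.congr_deriv ?_
    have := hv.ne_zero (X t)
    simp only [hu]
    field_simp
  have hD : |H (X b) - H (X a) - (b - a)| ≤ B' * |u a| / a₀ := by
    have h1 := image_norm_le_of_norm_deriv_right_le_deriv_boundary (a := a) (b := b)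
      (f := fun t => H (X t) - H (X a) - (t - a)) (f' := fun t => u t / v (X t))
      (B := fun t => B' * |u a| / a₀ * (1 - exp (-a₀ * (t - a))))
      (B' := fun t => B' * (|u a| * exp (-a₀ * (t - a))))
      (fun t _ => (hDd t).continuousAt.continuousWithinAt) (fun t _ => (hDd t).hasDerivWithinAt)
      (by simp) (fun t => by
        refine ((((((hasDerivAt_id' t).sub_const a).const_mul (-a₀)).exp).const_sub 1).const_mul
          (B' * |u a| / a₀)).congr_deriv ?_
        field_simp) (fun t ht => by
        rw [div_eq_mul_one_div, norm_mul, mul_comm]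
        exact mul_le_mul (hb' _) (hdecay t (Set.Ico_subset_Icc_self ht)) (norm_nonneg _) hB'.le)
      ⟨hab, le_rfl⟩
    refine h1.trans (mul_le_of_le_one_right (by positivity) ?_)
    linarith [exp_pos (-a₀ * (b - a))]
  have hua : |u a| ≤ (1 + B) * (1 + |deriv X a|) := by
    have h1 := abs_sub (deriv X a) (v (X a))
    have h2 := hb (X a)
    simp only [hu]
    nlinarith [abs_nonneg (deriv X a)]
  have heq : X b - X a - meanVelocity v * (b - a) =
      meanVelocity v * (H (X b) - H (X a) - (b - a)) - (meanVelocity v * H (X b) - X b) +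
        (meanVelocity v * H (X a) - X a) := by ring
  have h1 := abs_add_le (meanVelocity v * (H (X b) - H (X a) - (b - a)) -
    (meanVelocity v * H (X b) - X b)) (meanVelocity v * H (X a) - X a)
  have h2 := abs_sub (meanVelocity v * (H (X b) - H (X a) - (b - a)))
    (meanVelocity v * H (X b) - X b)
  have h3 : |meanVelocity v * (H (X b) - H (X a) - (b - a))| ≤
      |meanVelocity v| * (B' * ((1 + B) * (1 + |deriv X a|)) / a₀) := by
    rw [abs_mul]
    refine mul_le_mul_of_nonneg_left (hD.trans ?_) (abs_nonneg _)
    gcongr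
  have h4 : 2 * B'' ≤ 2 * B'' * (1 + |deriv X a|) :=
    le_mul_of_one_le_right (by positivity) (by linarith [abs_nonneg (deriv X a)])
  have h5 : (|meanVelocity v| * (B' * (1 + B) / a₀) + 2 * B'') * (1 + |deriv X a|) =
      |meanVelocity v| * (B' * ((1 + B) * (1 + |deriv X a|)) / a₀) +
        2 * B'' * (1 + |deriv X a|) := by ring
  rw [heq, h5]
  have h6 := hb'' (X a)
  have h7 := hb'' (X b)
  linarith

end Trajectory

/-! ### The driving force -/

theorem IsSwitch.abs_le_one {φ : ℝ → ℝ} (h : IsSwitch φ) (s : ℝ) : |φ s| ≤ 1 := by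
  rw [abs_le]
  constructor
  · rw [← h.right (max s 1) (le_max_right _ _)]
    exact h.anti (le_max_left _ _)
  · rw [← h.left (min s 0) (min_le_right _ _)]
    exact h.anti (min_le_left _ _)

section Drive

variable {E₁ E₂ T S δ : ℝ} {φ : ℝ → ℝ}

theorem abs_drive_le (hφ : IsSwitch φ) (h₁ : 0 < E₁) (h₂ : 0 < E₂) (τ : ℝ) :
    |drive E₁ E₂ T φ S δ τ| ≤ E₁ + E₂ := by
  have key : ∀ s, |s| ≤ 1 → |(E₁ - E₂) / 2 + (E₁ + E₂) / 2 * s| ≤ E₁ + E₂ := fun s hs => by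
    obtain ⟨h3, h4⟩ := abs_le.1 hs
    rw [abs_le]
    constructor <;> nlinarith
  rw [drive, driveOnPeriod]
  split_ifs
  · exact key _ (hφ.abs_le_one _)
  · have := key (-φ ((T * Int.fract (τ / T) - T + δ) / δ))
      (by rw [abs_neg]; exact hφ.abs_le_one _)
    rwa [mul_neg, ← sub_eq_add_neg] at this

theorem continuous_drive (hφ : IsSwitch φ) (hδ : 0 < δ) (hS : 0 < S) (hST : 2 * δ < T - S) :
    Continuous (drive E₁ E₂ T φ S δ) := by
  have hφc : Continuous φ := hφ.smooth.continuous
  have hc : Continuous (driveOnPeriod E₁ E₂ T φ S δ) := by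
    refine Continuous.if_le (by fun_prop) (by fun_prop) continuous_id continuous_const ?_
    rintro τ rfl
    have h1 : (S + δ - S) / δ = 1 := by rw [add_sub_cancel_left, div_self hδ.ne']
    rw [h1, hφ.right 1 le_rfl,
      hφ.left ((S + δ - T + δ) / δ) (div_nonpos_of_nonpos_of_nonneg (by linarith) hδ.le)]
    ring
  have h2 : Continuous ((fun s => driveOnPeriod E₁ E₂ T φ S δ (T * s)) ∘ Int.fract) := by
    refine ContinuousOn.comp_fract'' (by fun_prop) ?_
    have h3 : (T - T + δ) / δ = 1 := by rw [sub_self, zero_add, div_self hδ.ne']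
    rw [driveOnPeriod, driveOnPeriod, if_pos (by linarith), if_neg (by linarith), mul_zero, mul_one,
      h3, hφ.right 1 le_rfl, hφ.left ((0 - S) / δ) (div_nonpos_of_nonpos_of_nonneg (by linarith) hδ.le)]
    ring
  exact h2.comp (continuous_id.div_const T)

theorem drive_add_of_mem_Ico (hT : 0 < T) (n : ℕ) {τ : ℝ} (h0 : 0 ≤ τ) (h1 : τ < T) :
    drive E₁ E₂ T φ S δ (n * T + τ) = driveOnPeriod E₁ E₂ T φ S δ τ := by
  have h2 : (n * T + τ) / T = n + τ / T := by field_simp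
  rw [drive, h2, Int.fract_natCast_add,
    Int.fract_eq_self.2 ⟨div_nonneg h0 hT.le, (div_lt_one hT).2 h1⟩, mul_div_cancel₀ _ hT.ne']

theorem drive_eq_of_mem_left (hφ : IsSwitch φ) (hδ : 0 < δ) (hS : 0 < S) (hST : 2 * δ < T - S)
    (n : ℕ) {τ : ℝ} (h0 : 0 ≤ τ) (h1 : τ ≤ S) : drive E₁ E₂ T φ S δ (n * T + τ) = E₁ := by
  rw [drive_add_of_mem_Ico (by linarith) n h0 (by linarith), driveOnPeriod, if_pos (by linarith),
    hφ.left _ (div_nonpos_of_nonpos_of_nonneg (by linarith) hδ.le)]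
  ring

theorem drive_eq_of_mem_right (hφ : IsSwitch φ) (hδ : 0 < δ) (hS : 0 < S) (hST : 2 * δ < T - S)
    (n : ℕ) {τ : ℝ} (h0 : S + δ ≤ τ) (h1 : τ ≤ T - δ) :
    drive E₁ E₂ T φ S δ (n * T + τ) = -E₂ := by
  rw [drive_add_of_mem_Ico (by linarith) n (by linarith) (by linarith), driveOnPeriod]
  split_ifs with h
  · rw [hφ.right _ ((one_le_div hδ).2 (by linarith))]
    ring
  · rw [hφ.left _ (div_nonpos_of_nonpos_of_nonneg (by linarith) hδ.le)]
    ring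

/-- The zero-average condition fixes the switching time up to `O(δ)`. -/
theorem IsSwitchTime.abs_sub_le (h : IsSwitchTime E₁ E₂ T φ δ S) (hφ : IsSwitch φ) (hδ : 0 < δ)
    (h₁ : 0 < E₁) (h₂ : 0 < E₂) : |E₁ * S - E₂ * (T - S)| ≤ 4 * (E₁ + E₂) * δ := by
  obtain ⟨hS, hST, hint⟩ := h
  set D := drive E₁ E₂ T φ S δ with hD
  have hc : Continuous D := continuous_drive hφ hδ hS hST
  have hi : ∀ a b, IntervalIntegrable D volume a b := fun a b => hc.intervalIntegrable a b
  have hl : ∫ τ in (0 : ℝ)..S, D τ = E₁ * S := by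
    rw [intervalIntegral.integral_congr (g := fun _ => E₁) fun τ hτ => ?_]
    · simp [mul_comm]
    · rw [Set.uIcc_of_le hS.le] at hτ
      simpa using drive_eq_of_mem_left hφ hδ hS hST 0 hτ.1 hτ.2
  have hr : ∫ τ in (S + δ)..(T - δ), D τ = -E₂ * (T - 2 * δ - S) := by
    rw [intervalIntegral.integral_congr (g := fun _ => -E₂) fun τ hτ => ?_]
    · simp
      ring
    · rw [Set.uIcc_of_le (by linarith)] at hτ
      simpa using drive_eq_of_mem_right hφ hδ hS hST 0 hτ.1 hτ.2
  have hb : ∀ a b, b - a = δ → |∫ τ in a..b, D τ| ≤ (E₁ + E₂) * δ := fun a b hab => by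
    have := intervalIntegral.norm_integral_le_of_norm_le_const (a := a) (b := b) (f := D)
      (fun τ _ => abs_drive_le hφ h₁ h₂ τ)
    rwa [hab, abs_of_pos hδ] at this
  have e1 := intervalIntegral.integral_add_adjacent_intervals (hi 0 S) (hi S (S + δ))
  have e2 := intervalIntegral.integral_add_adjacent_intervals (hi 0 (S + δ)) (hi (S + δ) (T - δ))
  have e3 := intervalIntegral.integral_add_adjacent_intervals (hi 0 (T - δ)) (hi (T - δ) T)
  have b1 := abs_le.1 (hb S (S + δ) (by ring))
  have b2 := abs_le.1 (hb (T - δ) T (by ring))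
  rw [abs_le]
  constructor <;> nlinarith

end Drive

/-! ### The adiabatic limit -/

/-- An error `O(ε + δ)`, up to terms vanishing as `t → ∞` for fixed `ε`, yields the iterated
limits. -/
theorem isAdiabaticLimit_of_abs_sub_le {j : ℝ → ℝ → ℝ → ℝ} {J C : ℝ}
    (h : ∀ᶠ δ in 𝓝[>] (0 : ℝ), ∀ ε, 0 < ε → ∀ t, 0 < t →
      |j δ ε t - J| ≤ C * (ε + δ + (1 / ε + 1) / t)) : IsAdiabaticLimit j J := by
  have hcoe : ∀ {l : Filter ℝ} {f : ℝ → ℝ} {a : ℝ}, Tendsto f l (𝓝 a) →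
      Tendsto (fun x => ((f x : ℝ) : EReal)) l (𝓝 (a : EReal)) := fun hf =>
    (continuous_coe_real_ereal.tendsto _).comp hf
  have hpos : ∀ᶠ x in 𝓝[>] (0 : ℝ), 0 < x := eventually_mem_nhdsWithin
  have ht : ∀ (s K : ℝ) (ε δ : ℝ), Tendsto (fun t : ℝ => J + s * (C * (ε + δ + K / t))) atTop
      (𝓝 (J + s * (C * (ε + δ)))) := fun s K ε δ => by
    have h1 : Tendsto (fun t : ℝ => K / t) atTop (𝓝 0) := tendsto_const_nhds.div_atTop tendsto_id
    have h2 := (((h1.const_add (ε + δ)).const_mul C).const_mul s).const_add J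
    simpa using h2
  have hε : ∀ s δ : ℝ, Tendsto (fun ε : ℝ => J + s * (C * (ε + δ))) (𝓝[>] 0)
      (𝓝 (J + s * (C * δ))) := fun s δ => by
    have h1 : Continuous fun ε : ℝ => J + s * (C * (ε + δ)) := by fun_prop
    simpa using (h1.tendsto 0).mono_left nhdsWithin_le_nhds
  have hδ : ∀ s : ℝ, Tendsto (fun δ : ℝ => J + s * (C * δ)) (𝓝[>] 0) (𝓝 J) := fun s => by
    have h1 : Continuous fun δ : ℝ => J + s * (C * δ) := by fun_prop
    simpa using (h1.tendsto 0).mono_left nhdsWithin_le_nhds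
  have hlow : ∀ᶠ δ in 𝓝[>] (0 : ℝ), ((J + -1 * (C * δ) : ℝ) : EReal) ≤
      liminf (fun ε => liminf (fun t => ((j δ ε t : ℝ) : EReal)) atTop) (𝓝[>] 0) := by
    filter_upwards [h] with δ h
    rw [← (hcoe (hε (-1) δ)).liminf_eq]
    refine liminf_le_liminf ?_
    filter_upwards [hpos] with ε hε0
    rw [← (hcoe (ht (-1) (1 / ε + 1) ε δ)).liminf_eq]
    refine liminf_le_liminf ?_
    filter_upwards [eventually_gt_atTop 0] with t ht0
    rw [EReal.coe_le_coe_iff]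
    linarith [neg_le_of_abs_le (h ε hε0 t ht0)]
  have hupp : ∀ᶠ δ in 𝓝[>] (0 : ℝ),
      limsup (fun ε => limsup (fun t => ((j δ ε t : ℝ) : EReal)) atTop) (𝓝[>] 0) ≤
      ((J + 1 * (C * δ) : ℝ) : EReal) := by
    filter_upwards [h] with δ h
    rw [← (hcoe (hε 1 δ)).limsup_eq]
    refine limsup_le_limsup ?_
    filter_upwards [hpos] with ε hε0
    rw [← (hcoe (ht 1 (1 / ε + 1) ε δ)).limsup_eq]
    refine limsup_le_limsup ?_
    filter_upwards [eventually_gt_atTop 0] with t ht0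
    rw [EReal.coe_le_coe_iff]
    linarith [le_of_abs_le (h ε hε0 t ht0)]
  have hmid : ∀ δ : ℝ, liminf (fun ε => liminf (fun t => ((j δ ε t : ℝ) : EReal)) atTop) (𝓝[>] 0) ≤
      limsup (fun ε => limsup (fun t => ((j δ ε t : ℝ) : EReal)) atTop) (𝓝[>] 0) := fun δ =>
    (liminf_le_liminf (Eventually.of_forall fun ε => liminf_le_limsup)).trans liminf_le_limsup
  exact ⟨tendsto_of_tendsto_of_tendsto_of_le_of_le' (hcoe (hδ (-1))) (hcoe (hδ 1)) hlow
      (hupp.mono fun δ h => (hmid δ).trans h),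
    tendsto_of_tendsto_of_tendsto_of_le_of_le' (hcoe (hδ (-1))) (hcoe (hδ 1))
      (hlow.mono fun δ h => h.trans (hmid δ)) hupp⟩

section Current

variable {γ E₁ E₂ : ℝ} {U : ℝ → ℝ}

/-- Over each period of the force a trajectory moves by `T / ε` times the adiabatic current, up to
an error which is bounded during the phases of constant force and at most proportional to the
duration `δ / ε` of the two switches. The constant depends neither on `T`, `δ`, `ε` nor on the
profile, and `|v₀| + C` bounds the speed. -/
theorem exists_period_displacement_bound (hγ : 0 < γ) (hc : Continuous (deriv U))
    (hp : Function.Periodic U (2 * π)) (hE₁ : ∀ x, deriv U x < E₁) (hE₂ : ∀ x, -E₂ < deriv U x)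
    (h₁ : 0 < E₁) (h₂ : 0 < E₂) : ∃ C, 0 ≤ C ∧ ∀ (T S δ ε : ℝ) (φ : ℝ → ℝ), IsSwitch φ → 0 < δ →
      IsSwitchTime E₁ E₂ T φ δ S → 0 < ε → ∀ x₀ v₀ X,
      IsTrajectory γ U (fun t => drive E₁ E₂ T φ S δ (ε * t)) x₀ v₀ X →
      (∀ a b, 0 ≤ a → a ≤ b → |X b - X a| ≤ (|v₀| + C) * (b - a)) ∧
      ∀ n : ℕ, |X ((n + 1 : ℕ) * (T / ε)) - X (n * (T / ε)) - (E₂ * meanVelocity (cycle γ U E₁) +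
        E₁ * meanVelocity (cycle γ U (-E₂))) / (E₁ + E₂) * (T / ε)| ≤
        C * (1 + |v₀|) * (1 + δ / ε) := by
  have hc₁ := isCycle_cycle_of_lt hγ hc hp hE₁
  have hc₂ := isCycle_cycle_of_gt hγ hc hp hE₂
  have hpos₁ := hc₁.pos hγ hE₁
  have hneg₂ := hc₂.neg hγ hE₂
  obtain ⟨A, hA, ha⟩ := hp.deriv_periodic.exists_forall_abs_le two_pi_ne_zero hc
  have hτ₂ : ∫ x in (0 : ℝ)..(2 * π), 1 / cycle γ U (-E₂) x ≠ 0 := by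
    have h3 := hc₂.reflect.integral_inv_pos fun x => neg_pos.2 (hneg₂ (-x))
    have h4 := Function.Periodic.integral_comp_neg (f := fun x => 1 / cycle γ U (-E₂) x)
      (c := 2 * π) (fun x => by simp only [hc₂.periodic x])
    simp only [div_neg, intervalIntegral.integral_neg] at h3
    rw [h4] at h3
    linarith
  obtain ⟨C₁, hC₁, hb₁⟩ := hc₁.exists_displacement_bound hc hp.deriv_periodic
    (fun x => div_pos (sub_pos.2 (hE₁ x)) (hpos₁ x)) (hc₁.integral_inv_pos hpos₁).ne'
  obtain ⟨C₂, hC₂, hb₂⟩ := hc₂.exists_displacement_bound hc hp.deriv_periodic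
    (fun x => div_pos_of_neg_of_neg (sub_neg.2 (hE₂ x)) (hneg₂ x)) hτ₂
  set V₁ := meanVelocity (cycle γ U E₁)
  set V₂ := meanVelocity (cycle γ U (-E₂))
  set K := (E₁ + E₂ + A) / γ + 1
  have hK : 1 ≤ K := le_add_of_nonneg_left (by positivity)
  refine ⟨(C₁ + C₂ + 2) * (1 + K) + (4 * (|V₁| + |V₂|) + 2 * |V₂|), by positivity,
    fun T S δ ε φ hφ hδ hS hε x₀ v₀ X hX => ?_⟩
  have hΨ : ∀ t x, |(fun t => drive E₁ E₂ T φ S δ (ε * t)) t - deriv U x| ≤ E₁ + E₂ + A :=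
    fun t x => (abs_sub _ _).trans (add_le_add (abs_drive_le hφ h₁ h₂ _) (ha x))
  have hKC : K ≤ (C₁ + C₂ + 2) * (1 + K) + (4 * (|V₁| + |V₂|) + 2 * |V₂|) := by
    have : 0 ≤ (C₁ + C₂) * (1 + K) := by positivity
    have := abs_nonneg V₁
    have := abs_nonneg V₂
    linarith
  refine ⟨fun a b ha0 hab => (hX.abs_sub_le hγ hΨ ha0 hab).trans
      (mul_le_mul_of_nonneg_right (add_le_add_right hKC _) (sub_nonneg.2 hab)), fun n => ?_⟩
  have hSδ := hS.abs_sub_le hφ hδ h₁ h₂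
  obtain ⟨hS0, hST, -⟩ := hS
  have hT : 0 < T := by linarith
  -- `a` is the start of the period; the force is constant on `[a, a + S / ε]` and on
  -- `[a + (S + δ) / ε, a + (T - δ) / ε]`
  set a := n * (T / ε) with hadef
  have ha0 : 0 ≤ a := by positivity
  have hea : ε * a = n * T := by rw [hadef]; field_simp
  have hb4 : ((n + 1 : ℕ) : ℝ) * (T / ε) = a + T / ε := by rw [hadef]; push_cast; ring
  have hdiv : ∀ {s r : ℝ}, s ≤ r → s / ε ≤ r / ε := fun h => div_le_div_of_nonneg_right h hε.le
  have hvel : ∀ t, 0 ≤ t → 1 + |deriv X t| ≤ (1 + K) * (1 + |v₀|) := fun t ht => by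
    have h3 := hX.abs_deriv_le hγ hΨ ht
    nlinarith [abs_nonneg v₀]
  have p1 : |X (a + S / ε) - X a - V₁ * (S / ε)| ≤ C₁ * ((1 + K) * (1 + |v₀|)) := by
    have h3 := hb₁ _ _ _ X hX a (a + S / ε) (by linarith [div_pos hS0 hε]) fun t ht => by
      have h4 : ε * (S / ε) = S := by field_simp
      have h5 : ε * t = n * T + (ε * t - ε * a) := by rw [hea]; ring
      have h6 := mul_le_mul_of_nonneg_left ht.1 hε.le
      have h7 := mul_le_mul_of_nonneg_left ht.2 hε.le
      rw [h5]
      exact drive_eq_of_mem_left hφ hδ hS0 hST n (by linarith) (by linarith)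
    rw [add_sub_cancel_left] at h3
    exact h3.trans (mul_le_mul_of_nonneg_left (hvel a ha0) hC₁)
  have hS1 := div_pos hS0 hε
  have hδ1 := div_pos hδ hε
  have hmid : (S + δ) / ε ≤ (T - δ) / ε := hdiv (by linarith)
  have hsum : (S + δ) / ε = S / ε + δ / ε := add_div _ _ _
  have hsub : (T - δ) / ε = T / ε - δ / ε := sub_div _ _ _
  have p3 : |X (a + (T - δ) / ε) - X (a + (S + δ) / ε) - V₂ * ((T - δ) / ε - (S + δ) / ε)| ≤
      C₂ * ((1 + K) * (1 + |v₀|)) := by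
    have h3 := hb₂ _ _ _ X hX (a + (S + δ) / ε) (a + (T - δ) / ε) (by linarith) fun t ht => by
      have h4 : ε * ((S + δ) / ε) = S + δ := by field_simp
      have h4' : ε * ((T - δ) / ε) = T - δ := by field_simp
      have h5 : ε * t = n * T + (ε * t - ε * a) := by rw [hea]; ring
      have h6 := mul_le_mul_of_nonneg_left ht.1 hε.le
      have h7 := mul_le_mul_of_nonneg_left ht.2 hε.le
      rw [h5]
      exact drive_eq_of_mem_right hφ hδ hS0 hST n (by linarith) (by linarith)
    rw [add_sub_add_left_eq_sub] at h3
    exact h3.trans (mul_le_mul_of_nonneg_left (hvel _ (by linarith)) hC₂)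
  have hKv : (|v₀| + K) * (δ / ε) ≤ (1 + K) * (1 + |v₀|) * (δ / ε) := by
    refine mul_le_mul_of_nonneg_right ?_ hδ1.le
    nlinarith [abs_nonneg v₀]
  have p2 : |X (a + (S + δ) / ε) - X (a + S / ε)| ≤ (1 + K) * (1 + |v₀|) * (δ / ε) := by
    have h3 := hX.abs_sub_le hγ hΨ (a := a + S / ε) (b := a + (S + δ) / ε) (by linarith)
      (by linarith)
    rw [show a + (S + δ) / ε - (a + S / ε) = δ / ε by rw [hsum]; ring] at h3
    exact h3.trans hKv
  have p4 : |X (a + T / ε) - X (a + (T - δ) / ε)| ≤ (1 + K) * (1 + |v₀|) * (δ / ε) := by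
    have h3 := hX.abs_sub_le hγ hΨ (a := a + (T - δ) / ε) (b := a + T / ε) (by linarith)
      (by linarith)
    rw [show a + T / ε - (a + (T - δ) / ε) = δ / ε by rw [hsub]; ring] at h3
    exact h3.trans hKv
  -- the average of the mean velocities over the period
  have p5 : |V₁ * (S / ε) + V₂ * ((T - δ) / ε - (S + δ) / ε) -
      (E₂ * V₁ + E₁ * V₂) / (E₁ + E₂) * (T / ε)| ≤ (4 * (|V₁| + |V₂|) + 2 * |V₂|) * (δ / ε) := by
    have h3 : V₁ * (S / ε) + V₂ * ((T - δ) / ε - (S + δ) / ε) -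
        (E₂ * V₁ + E₁ * V₂) / (E₁ + E₂) * (T / ε) =
        (V₁ - V₂) * ((E₁ * S - E₂ * (T - S)) / (E₁ + E₂) / ε) - 2 * V₂ * (δ / ε) := by
      field_simp
      ring
    have h4 : |(E₁ * S - E₂ * (T - S)) / (E₁ + E₂) / ε| ≤ 4 * (δ / ε) := by
      rw [abs_div, abs_div, abs_of_pos hε, abs_of_pos (by positivity : 0 < E₁ + E₂), ← mul_div_assoc]
      refine hdiv ?_
      rw [div_le_iff₀ (by positivity)]
      linarith
    have h5 := abs_sub ((V₁ - V₂) * ((E₁ * S - E₂ * (T - S)) / (E₁ + E₂) / ε)) (2 * V₂ * (δ / ε))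
    have h6 : |(V₁ - V₂) * ((E₁ * S - E₂ * (T - S)) / (E₁ + E₂) / ε)| ≤
        (|V₁| + |V₂|) * (4 * (δ / ε)) := by
      rw [abs_mul]
      exact mul_le_mul (abs_sub _ _) h4 (abs_nonneg _) (by positivity)
    have h7 : |2 * V₂ * (δ / ε)| = 2 * |V₂| * (δ / ε) := by
      rw [abs_mul, abs_mul, abs_of_pos hδ1, abs_two]
    rw [h3]
    linarith
  have heq : X (a + T / ε) - X a - (E₂ * V₁ + E₁ * V₂) / (E₁ + E₂) * (T / ε) =
      (X (a + S / ε) - X a - V₁ * (S / ε)) + (X (a + (S + δ) / ε) - X (a + S / ε)) +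
      (X (a + (T - δ) / ε) - X (a + (S + δ) / ε) - V₂ * ((T - δ) / ε - (S + δ) / ε)) +
      (X (a + T / ε) - X (a + (T - δ) / ε)) +
      (V₁ * (S / ε) + V₂ * ((T - δ) / ε - (S + δ) / ε) -
        (E₂ * V₁ + E₁ * V₂) / (E₁ + E₂) * (T / ε)) := by ring
  have tri : ∀ p q r s u : ℝ, |p + q + r + s + u| ≤ |p| + |q| + |r| + |s| + |u| :=
    fun p q r s u => by
      have i1 := abs_add_le (p + q + r + s) u
      have i2 := abs_add_le (p + q + r) s
      have i3 := abs_add_le (p + q) r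
      have i4 := abs_add_le p q
      linarith
  rw [hb4, heq]
  refine (tri _ _ _ _ _).trans ?_
  have hW : 0 ≤ 4 * (|V₁| + |V₂|) + 2 * |V₂| := by positivity
  generalize 4 * (|V₁| + |V₂|) + 2 * |V₂| = W at *
  have hv0 := abs_nonneg v₀
  have q1 : 0 ≤ (C₁ + C₂) * (1 + K) * (1 + |v₀|) * (δ / ε) := by positivity
  have q2 : 0 ≤ 2 * (1 + K) * (1 + |v₀|) := by positivity
  have q3 : 0 ≤ W * (1 + |v₀|) := by positivity
  have q4 : 0 ≤ W * |v₀| * (δ / ε) := by positivity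
  have q5 : ((C₁ + C₂ + 2) * (1 + K) + W) * (1 + |v₀|) * (1 + δ / ε) =
      C₁ * ((1 + K) * (1 + |v₀|)) + C₂ * ((1 + K) * (1 + |v₀|)) + 2 * ((1 + K) * (1 + |v₀|) * (δ / ε)) +
      W * (δ / ε) + ((C₁ + C₂) * (1 + K) * (1 + |v₀|) * (δ / ε) + 2 * (1 + K) * (1 + |v₀|) +
      W * (1 + |v₀|) + W * |v₀| * (δ / ε)) := by ring
  linarith

variable {L : NNReal}

/-- The displacement up to time `t`: a sum over about `t ε / T` complete periods, and a remainder of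
less than a period. -/
theorem exists_position_bound (hγ : 0 < γ) (hc : Continuous (deriv U))
    (hp : Function.Periodic U (2 * π)) (hE₁ : ∀ x, deriv U x < E₁) (hE₂ : ∀ x, -E₂ < deriv U x)
    (h₁ : 0 < E₁) (h₂ : 0 < E₂) {T : ℝ} (hT : 0 < T) : ∃ C, 0 ≤ C ∧
      ∀ (S δ ε : ℝ) (φ : ℝ → ℝ), IsSwitch φ → 0 < δ → IsSwitchTime E₁ E₂ T φ δ S → 0 < ε →
      ∀ x₀ v₀ X, IsTrajectory γ U (fun t => drive E₁ E₂ T φ S δ (ε * t)) x₀ v₀ X →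
      ∀ t, 0 < t → |X t - x₀ - (E₂ * meanVelocity (cycle γ U E₁) +
        E₁ * meanVelocity (cycle γ U (-E₂))) / (E₁ + E₂) * t| ≤
        C * (1 + |v₀|) * (t * (ε + δ) + 1 / ε) := by
  obtain ⟨C, hC, hper⟩ := exists_period_displacement_bound hγ hc hp hE₁ hE₂ h₁ h₂
  generalize (E₂ * meanVelocity (cycle γ U E₁) +
    E₁ * meanVelocity (cycle γ U (-E₂))) / (E₁ + E₂) = J at *
  refine ⟨C / T + (1 + C + |J|) * T, by positivity,
    fun S δ ε φ hφ hδ hS hε x₀ v₀ X hX t ht => ?_⟩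
  obtain ⟨hpos, hstep⟩ := hper T S δ ε φ hφ hδ hS hε x₀ v₀ X hX
  have hv := abs_nonneg v₀
  set P := T / ε with hP
  have hP0 : 0 < P := div_pos hT hε
  set M := C * (1 + |v₀|) * (1 + δ / ε) with hM
  have hM0 : 0 ≤ M := by positivity
  have hsum : ∀ n : ℕ, |X (n * P) - x₀ - n * (J * P)| ≤ n * M := fun n => by
    induction n with
    | zero => simp [hX.position]
    | succ n ih =>
      have h3 := abs_add_le (X (n * P) - x₀ - n * (J * P))
        (X ((n + 1 : ℕ) * P) - X (n * P) - J * P)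
      have h4 : X ((n + 1 : ℕ) * P) - x₀ - (n + 1 : ℕ) * (J * P) =
          X (n * P) - x₀ - n * (J * P) + (X ((n + 1 : ℕ) * P) - X (n * P) - J * P) := by
        push_cast; ring
      rw [h4]
      have h5 := hstep n
      push_cast at h3 h5 ⊢
      linarith
  set n := ⌊t / P⌋₊ with hn
  have hn1 : n * P ≤ t := (le_div_iff₀ hP0).1 (Nat.floor_le (by positivity))
  have hn2 : t < (n + 1) * P := (div_lt_iff₀ hP0).1 (Nat.lt_floor_add_one _)
  have h3 := hsum n
  have h4 := hpos (n * P) t (by positivity) hn1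
  have h5 : n * M ≤ C / T * (1 + |v₀|) * (t * (ε + δ)) := by
    calc n * M ≤ t / P * M := by
          gcongr
          rw [le_div_iff₀ hP0]
          exact hn1
      _ = _ := by
          rw [hM, hP]
          field_simp
  have h6 : (|v₀| + C) * (t - n * P) ≤ (|v₀| + C) * P :=
    mul_le_mul_of_nonneg_left (by linarith) (by positivity)
  have h7 : |J * (t - n * P)| ≤ |J| * P := by
    rw [abs_mul, abs_of_nonneg (sub_nonneg.2 hn1)]
    exact mul_le_mul_of_nonneg_left (by linarith) (abs_nonneg _)
  have heq : X t - x₀ - J * t = X (n * P) - x₀ - n * (J * P) + (X t - X (n * P)) -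
      J * (t - n * P) := by ring
  have h8 := abs_sub (X (n * P) - x₀ - n * (J * P) + (X t - X (n * P))) (J * (t - n * P))
  have h9 := abs_add_le (X (n * P) - x₀ - n * (J * P)) (X t - X (n * P))
  have h10 : (C / T + (1 + C + |J|) * T) * (1 + |v₀|) * (t * (ε + δ) + 1 / ε) =
      C / T * (1 + |v₀|) * (t * (ε + δ)) + (|v₀| + C) * P + |J| * P +
      (C / T * (1 + |v₀|) * (1 / ε) + (1 + C + |J|) * T * (1 + |v₀|) * (t * (ε + δ)) +
      (1 + C * |v₀| + |J| * |v₀|) * P) := by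
    rw [hP]
    field_simp
    ring
  have h11 : 0 ≤ C / T * (1 + |v₀|) * (1 / ε) + (1 + C + |J|) * T * (1 + |v₀|) * (t * (ε + δ)) +
      (1 + C * |v₀| + |J| * |v₀|) * P := by positivity
  rw [heq, h10]
  linarith

theorem measurable_drift {F : ℝ → ℝ} (hγ : 0 < γ) (hL : LipschitzWith L (deriv U))
    (hF : Continuous F) {Φ : ℝ} (hΦ : ∀ t, |F t| ≤ Φ) {t : ℝ} (ht : 0 ≤ t) :
    Measurable (drift γ U F t) := by
  have : Fact (0 < 2 * π) := ⟨two_pi_pos⟩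
  have h1 : Measurable fun p : AddCircle (2 * π) × ℝ =>
      ((AddCircle.equivIco (2 * π) 0 p.1 : ℝ), p.2) :=
    ((measurable_subtype_coe.comp (AddCircle.measurableEquivIco (2 * π) 0).measurable).comp
      measurable_fst).prodMk measurable_snd
  exact ((continuous_trajectory hγ hL hF hΦ ht).measurable.comp h1).div_const t

/-- For fields `E₁ > max U'` and `-E₂ < min U'` the adiabatic current exists and is the average of
the mean velocities over the two phases, whose durations are in the ratio `E₂ : E₁`. -/
theorem isAdiabaticCurrent (hγ : 0 < γ) (hL : LipschitzWith L (deriv U))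
    (hp : Function.Periodic U (2 * π)) (hE₁ : ∀ x, deriv U x < E₁) (hE₂ : ∀ x, -E₂ < deriv U x)
    (h₁ : 0 < E₁) (h₂ : 0 < E₂) : IsAdiabaticCurrent γ U E₁ E₂
      ((E₂ * meanVelocity (cycle γ U E₁) + E₁ * meanVelocity (cycle γ U (-E₂))) / (E₁ + E₂)) := by
  intro T φ S μ hT hφ hS hμ hmom
  have : Fact (0 < 2 * π) := ⟨two_pi_pos⟩
  obtain ⟨C, hC, hpos⟩ := exists_position_bound hγ hL.continuous hp hE₁ hE₂ h₁ h₂ hT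
  generalize (E₂ * meanVelocity (cycle γ U E₁) +
    E₁ * meanVelocity (cycle γ U (-E₂))) / (E₁ + E₂) = J at *
  have hFc : ∀ {δ : ℝ}, 0 < δ → IsSwitchTime E₁ E₂ T φ δ (S δ) → ∀ ε : ℝ,
      Continuous fun t => drive E₁ E₂ T φ (S δ) δ (ε * t) := fun hδ h ε =>
    (continuous_drive hφ hδ h.1 h.2.1).comp (continuous_const.mul continuous_id)
  have hFb : ∀ δ ε t : ℝ, |drive E₁ E₂ T φ (S δ) δ (ε * t)| ≤ E₁ + E₂ := fun δ ε t =>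
    abs_drive_le hφ h₁ h₂ _
  have hdrift : ∀ {δ : ℝ}, 0 < δ → IsSwitchTime E₁ E₂ T φ δ (S δ) → ∀ {ε : ℝ}, 0 < ε →
      ∀ {t : ℝ}, 0 < t → ∀ p : AddCircle (2 * π) × ℝ,
      |drift γ U (fun s => drive E₁ E₂ T φ (S δ) δ (ε * s)) t p - J| ≤
        (C + 2 * π) * (ε + δ + (1 / ε + 1) / t) * (1 + |p.2|) := by
    intro δ hδ h ε hε t ht p
    set x₀ : ℝ := (AddCircle.equivIco (2 * π) 0 p.1).1
    have hx : |x₀| ≤ 2 * π := by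
      have h3 : 0 ≤ x₀ ∧ x₀ < 0 + 2 * π := (AddCircle.equivIco (2 * π) 0 p.1).2
      rw [abs_of_nonneg h3.1]
      linarith [h3.2]
    have h4 := hpos (S δ) δ ε φ hφ hδ h hε x₀ p.2 _
      (isTrajectory_trajectory hγ hL (hFc hδ h ε) (hFb δ ε) x₀ p.2) t ht
    have h5 : drift γ U (fun s => drive E₁ E₂ T φ (S δ) δ (ε * s)) t p =
        trajectory γ U (fun s => drive E₁ E₂ T φ (S δ) δ (ε * s)) x₀ p.2 t / t := rfl
    rw [h5]
    generalize trajectory γ U (fun s => drive E₁ E₂ T φ (S δ) δ (ε * s)) x₀ p.2 t = X at *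
    have h6 : X / t - J = (X - x₀ - J * t + x₀) / t := by field_simp; ring
    have h7 := abs_add_le (X - x₀ - J * t) x₀
    have hv := abs_nonneg p.2
    rw [h6, abs_div, abs_of_pos ht, div_le_iff₀ ht]
    have h8 : (C + 2 * π) * (ε + δ + (1 / ε + 1) / t) * (1 + |p.2|) * t =
        C * (1 + |p.2|) * (t * (ε + δ) + 1 / ε) + 2 * π + (C * (1 + |p.2|) + 2 * π * |p.2| +
          2 * π * (1 + |p.2|) * (t * (ε + δ) + 1 / ε)) := by
      field_simp
      ring
    have h9 : 0 ≤ C * (1 + |p.2|) + 2 * π * |p.2| +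
          2 * π * (1 + |p.2|) * (t * (ε + δ) + 1 / ε) := by positivity
    rw [h8]
    linarith
  have hmeas : ∀ {δ : ℝ}, 0 < δ → IsSwitchTime E₁ E₂ T φ δ (S δ) → ∀ {ε : ℝ}, 0 < ε →
      ∀ {t : ℝ}, 0 < t →
      Measurable (drift γ U (fun s => drive E₁ E₂ T φ (S δ) δ (ε * s)) t) := fun hδ h ε _ t ht =>
    measurable_drift hγ hL (hFc hδ h ε) (hFb _ ε) ht.le
  have hint1 : Integrable (fun p : AddCircle (2 * π) × ℝ => 1 + |p.2|) μ := by
    refine hmom.mono' (measurable_const.add measurable_snd.norm).aestronglyMeasurable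
      (Eventually.of_forall fun p => ?_)
    have hv := abs_nonneg p.2
    rw [Real.norm_of_nonneg (by positivity)]
    refine le_mul_of_one_le_right (by positivity) ?_
    rw [le_log_iff_exp_le (by positivity)]
    linarith
  have hintd : ∀ {δ : ℝ}, 0 < δ → IsSwitchTime E₁ E₂ T φ δ (S δ) → ∀ {ε : ℝ}, 0 < ε →
      ∀ {t : ℝ}, 0 < t →
      Integrable (drift γ U (fun s => drive E₁ E₂ T φ (S δ) δ (ε * s)) t) μ := by
    intro δ hδ h ε hε t ht
    refine ((hint1.const_mul ((C + 2 * π) * (ε + δ + (1 / ε + 1) / t))).add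
      (integrable_const |J|)).mono' (hmeas hδ h hε ht).aestronglyMeasurable
      (Eventually.of_forall fun p => ?_)
    have h3 := hdrift hδ h hε ht p
    have h4 := abs_add_le (drift γ U (fun s => drive E₁ E₂ T φ (S δ) δ (ε * s)) t p - J) J
    rw [sub_add_cancel] at h4
    simp only [Pi.add_apply, Real.norm_eq_abs]
    linarith
  refine ⟨fun δ hδ h ε hε => ⟨fun x₀ v₀ =>
    existsUnique_isTrajectory hγ hL (hFc hδ h ε) (hFb δ ε) x₀ v₀, fun t ht => hintd hδ h hε ht⟩, ?_⟩
  refine isAdiabaticLimit_of_abs_sub_le (C := (C + 2 * π) * ∫ p, (1 + |p.2|) ∂μ) ?_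
  filter_upwards [hS, eventually_mem_nhdsWithin] with δ h hδ ε hε t ht
  have h3 : current γ U (fun s => drive E₁ E₂ T φ (S δ) δ (ε * s)) μ t - J =
      ∫ p, (drift γ U (fun s => drive E₁ E₂ T φ (S δ) δ (ε * s)) t p - J) ∂μ := by
    rw [integral_sub (hintd hδ h hε ht) (integrable_const J), current]
    simp
  have h4 := norm_integral_le_of_norm_le
    (hint1.const_mul ((C + 2 * π) * (ε + δ + (1 / ε + 1) / t)))
    (Eventually.of_forall fun p => (Real.norm_eq_abs _).trans_le (hdrift hδ h hε ht p))
  rw [integral_const_mul] at h4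
  rw [h3]
  exact h4.trans (le_of_eq (by ring))

end Current

theorem mainTheorem3 (γ : ℝ) (hγ : 0 < γ) (U : ℝ → ℝ) (hU : ContDiff ℝ 2 U)
    (hper : Function.Periodic U (2 * π)) (hnc : ¬ ∃ a : ℝ, ∀ x, U x = a) :
    -- the cycles `v_E` exist and are unique
    (∀ E : ℝ, slopeMax U < E →
      (∃! v : ℝ → ℝ, IsCycle γ U E v) ∧ ∀ x, 0 < cycle γ U E x) ∧
    (∀ E : ℝ, E < -slopeNegMin U →
      (∃! v : ℝ → ℝ, IsCycle γ U E v) ∧ ∀ x, cycle γ U E x < 0) ∧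
    (∀ E : ℝ, slopeNegMin U < E → IsCycle γ (reflPot U) E (reflCycle γ U E)) ∧
    -- asymptotic expansions of the cycles
    (∃ c : ℕ → ℝ → ℝ,
      IsCoeffSequence γ U c ∧
      HasLargeFieldExpansion γ c (cycle γ U) ∧
      IsCoeffSequence γ (reflPot U) (fun k x => (-1) ^ (k + 1) * c k (-x)) ∧
      HasLargeFieldExpansion γ (fun k x => (-1) ^ (k + 1) * c k (-x)) (reflCycle γ U)) ∧
    -- the adiabatic current for `E₁ = E + Δ`, `E₂ = E`
    ∀ Δ : ℝ, Δ ≠ 0 → ∃ J : ℝ → ℝ,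
      (∀ E : ℝ, slopeMax U < E + Δ → slopeNegMin U < E →
        IsAdiabaticCurrent γ U (E + Δ) E (J E) ∧
        J E = (E * meanVelocity (cycle γ U (E + Δ)) + (E + Δ) * meanVelocity (cycle γ U (-E))) /
          (2 * E + Δ)) ∧
      ((∫ x in (0 : ℝ)..(2 * π), U x = 0) →
        ∃ C E₀ : ℝ, 0 < E₀ ∧ slopeMax U < E₀ + Δ ∧ slopeNegMin U < E₀ ∧
          ∀ E, E₀ ≤ E → ∃ r : ℝ, |r| ≤ C / E ^ 7 ∧
            J E = meanVelocity (cycle γ U (E + Δ)) * meanVelocity (reflCycle γ U E) * γ ^ 5 /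
                (2 * π * (2 * E + Δ)) *
              ((1 / E ^ 4 - 1 / (E + Δ) ^ 4) * (∫ x in (0 : ℝ)..(2 * π), U x ^ 2) + r)) ∧
      (∃ E₀ : ℝ, 0 < E₀ ∧ slopeMax U < E₀ + Δ ∧ slopeNegMin U < E₀ ∧
        ∀ E, E₀ ≤ E → (0 < J E ↔ 0 < Δ) ∧ (J E < 0 ↔ Δ < 0)) := by
  have hd : Differentiable ℝ U := hU.differentiable two_ne_zero
  obtain ⟨L, hL⟩ := exists_lipschitzWith_deriv hU hper
  have hc : Continuous (deriv U) := hL.continuous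
  have hp' := hper.deriv_periodic
  obtain ⟨A, hA, ha⟩ := hp'.exists_forall_abs_le two_pi_ne_zero hc
  have hsup : ∀ {E : ℝ}, slopeMax U < E → ∀ x, deriv U x < E := fun h x =>
    (deriv_le_slopeMax hc hp' x).trans_lt h
  have hinf : ∀ {E : ℝ}, slopeNegMin U < E → ∀ x, -E < deriv U x := fun h x =>
    (neg_lt_neg h).trans_le (neg_slopeNegMin_le_deriv hc hp' x)
  have hinf' : ∀ {E : ℝ}, E < -slopeNegMin U → ∀ x, E < deriv U x := fun h x =>
    h.trans_le (neg_slopeNegMin_le_deriv hc hp' x)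
  have hcyc : ∀ E, A + 1 ≤ E → IsCycle γ U E (cycle γ U E) := fun E hE =>
    isCycle_cycle_of_lt hγ hc hper fun x => by linarith [le_of_abs_le (ha x)]
  have hrefl : ∀ E, A + 1 ≤ E → IsCycle γ (reflPot U) E (reflCycle γ U E) := fun E hE =>
    isCycle_reflCycle hγ hc hper fun x => by linarith [neg_le_of_abs_le (ha x)]
  have hs := isCoeffSequence_cycleCoeff (γ := γ) hd hc hper
  refine ⟨fun E hE => ⟨existsUnique_isCycle_of_lt hγ hc hp' (hsup hE),
      (isCycle_cycle_of_lt hγ hc hper (hsup hE)).pos hγ (hsup hE)⟩,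
    fun E hE => ⟨existsUnique_isCycle_of_gt hγ hc hper (hinf' hE),
      (isCycle_cycle_of_gt hγ hc hper (hinf' hE)).neg hγ (hinf' hE)⟩,
    fun E hE => isCycle_reflCycle hγ hc hper (hinf hE),
    ⟨cycleCoeff γ U, hs, hasLargeFieldExpansion_of_isCycle hs hγ hd hc hper hcyc, hs.reflect,
      hasLargeFieldExpansion_of_isCycle hs.reflect hγ (hd.comp differentiable_neg)
        (continuous_deriv_reflPot hc) (periodic_reflPot hper) hrefl⟩,
    fun Δ hΔ => ⟨fun E => (E * meanVelocity (cycle γ U (E + Δ)) +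
      (E + Δ) * meanVelocity (cycle γ U (-E))) / (2 * E + Δ), fun E h₁ h₂ => ⟨?_, rfl⟩, ?_⟩⟩
  · -- the slope vanishes at a maximum of `U`, so both amplitudes are positive
    obtain ⟨x₀, -, h0⟩ := hper.exists_max_hasDerivAt two_pi_ne_zero fun x => (hd x).hasDerivAt
    have p₁ := hsup h₁ x₀
    have p₂ := hinf h₂ x₀
    rw [h0] at p₁ p₂
    have h3 := isAdiabaticCurrent hγ hL hper (hsup h₁) (hinf h₂) p₁ (by linarith)
    rwa [show E + Δ + E = 2 * E + Δ by ring] at h3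
  · obtain ⟨C, E₁, hE₁, hB⟩ := exists_abs_period_sub_le hγ hd hc hper Δ
    have hI := hs.integral_sq_pos hγ.ne' hd hnc
    have hΔ0 := abs_pos.2 hΔ
    have hΔ1 := neg_abs_le Δ
    have hM := slopeMax_le ha
    have hm := slopeNegMin_le ha
    -- `|U'| ≤ A` and `A + |Δ| < E` put both fields beyond the slopes of `U`
    have hval : ∀ E, A + |Δ| < E → _ := fun E hE =>
      have q₁ : ∀ x, deriv U x < E + Δ := fun x => by linarith [le_of_abs_le (ha x)]
      have q₂ : ∀ x, -E < deriv U x := fun x => by linarith [neg_le_of_abs_le (ha x)]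
      have c₁ := isCycle_cycle_of_lt hγ hc hper q₁
      have c₂ := isCycle_cycle_of_gt hγ hc hper q₂
      current_value_eq c₁ (c₁.pos hγ q₁) c₂ (c₂.neg hγ q₂)
    refine ⟨fun h0 => ⟨C / γ ^ 5, E₁ + A + |Δ| + 1, by positivity, by linarith, by linarith,
      fun E hE => ?_⟩, ?_⟩
    · have h3 := hB E (by linarith)
      have h4 : γ ^ 3 * ∫ x in (0 : ℝ)..(2 * π), cycleCoeff γ U 1 x ^ 2 =
          γ ^ 5 * ∫ x in (0 : ℝ)..(2 * π), U x ^ 2 := by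
        simp only [hs.first_eq hd h0, mul_pow, intervalIntegral.integral_const_mul]
        ring
      rw [h4] at h3
      simp only
      rw [hval E (by linarith)]
      generalize E * (∫ x in (0 : ℝ)..(2 * π), 1 / reflCycle γ U E x) -
        (E + Δ) * (∫ x in (0 : ℝ)..(2 * π), 1 / cycle γ U (E + Δ) x) = B at h3 ⊢
      refine ⟨(B - (1 / E ^ 4 - 1 / (E + Δ) ^ 4) * (γ ^ 5 * ∫ x in (0 : ℝ)..(2 * π), U x ^ 2)) /
        γ ^ 5, ?_, ?_⟩
      · rw [abs_div, abs_of_pos (pow_pos hγ 5), div_right_comm]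
        exact div_le_div_of_nonneg_right h3 (pow_pos hγ 5).le
      · have h5 : ∀ W Z b : ℝ, W * γ ^ 5 / Z * ((1 / E ^ 4 - 1 / (E + Δ) ^ 4) * b +
            (B - (1 / E ^ 4 - 1 / (E + Δ) ^ 4) * (γ ^ 5 * b)) / γ ^ 5) = W / Z * B := fun W Z b => by
          field_simp
          ring
        rw [h5]
    · -- `J` is a positive multiple of the difference `B` of the periods
      set I := γ ^ 3 * ∫ x in (0 : ℝ)..(2 * π), cycleCoeff γ U 1 x ^ 2 with hIdef
      have hI0 : 0 < I := mul_pos (pow_pos hγ 3) hI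
      have hq : 0 ≤ 16 * |C| / (I * |Δ|) := by positivity
      refine ⟨E₁ + A + 2 * |Δ| + 1 + 16 * |C| / (I * |Δ|), by positivity, by linarith,
        by linarith, fun E hE => ?_⟩
      have hsign := mul_pos_of_abs_sub_le hI0 hΔ (by linarith) (by linarith) (by linarith)
        (hB E (by linarith))
      have hV := meanVelocity_pos (hcyc (E + Δ) (by linarith))
        ((hcyc (E + Δ) (by linarith)).pos hγ fun x => by linarith [le_of_abs_le (ha x)])
      have hV' := meanVelocity_pos (hrefl E (by linarith)) ((hrefl E (by linarith)).pos hγ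
        fun x => by rw [deriv_reflPot]; linarith [neg_le_of_abs_le (ha (-x))])
      simp only
      rw [hval E (by linarith)]
      generalize E * (∫ x in (0 : ℝ)..(2 * π), 1 / reflCycle γ U E x) -
        (E + Δ) * (∫ x in (0 : ℝ)..(2 * π), 1 / cycle γ U (E + Δ) x) = B at hsign ⊢
      have hW : 0 < meanVelocity (cycle γ U (E + Δ)) * meanVelocity (reflCycle γ U E) /
          (2 * π * (2 * E + Δ)) :=
        div_pos (mul_pos hV hV') (mul_pos two_pi_pos (by linarith))
      rcases mul_pos_iff.1 hsign with ⟨s₁, s₂⟩ | ⟨s₁, s₂⟩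
      · exact ⟨iff_of_true (mul_pos hW s₂) s₁, iff_of_false (mul_pos hW s₂).not_gt s₁.not_gt⟩
      · have s₃ := mul_neg_of_pos_of_neg hW s₂
        exact ⟨iff_of_false s₃.not_gt s₁.not_gt, iff_of_true s₃ s₁⟩
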